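/- **Setting.** Let $m,p$ be natural numbers, $k_1,\dots,k_m>0$, $\epsilon>0$, $0<\delta<1$. Put $\kappa_{\delta,\epsilon}=\frac{1}{2\epsilon}\bigl(K_\delta+\sqrt{K_\delta^2+2\epsilon}\bigr)$ with $K_\delta=\mathcal Q^{-1}(\delta)$, $\mathcal Q(x)=\frac1{\sqrt{2\pi}}\int_x^\infty e^{-u^2/2}\,du$, and $K=\mathrm{diag}(k_1,\dots,k_m)$. Systems are causal, linear, time-invariant, with real coefficients, and are given by their impulse response $(F_t)_{t\ge 0}$; $F(z)=\sum_{t\ge0}F_tz^{-t}$, the $H_2$ norm is $\|F\|_2=(\sum_{t}\sum_{i,j}|F_{t,ij}|^2)^{1/2}$, a system is called stable if $\|F\|_2<\infty$, and then its frequency response $F(e^{j\omega})$ is the sum of the series in $L^2([-\pi,\pi),d\omega/2\pi)$. Two signals $u,u':\mathbb N\to\mathbb R^m$ are adjacent if for every $i$ there are $t_i\in\mathbb N$ and $|\alpha_i|\le k_i$ with $u'_i-u_i=\alpha_i\delta_{t_i}$ (the impulse at time $t_i$), and the sensitivity of a system $G$ is $\Delta_2G=\sup\|Gu-Gu'\|_2$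 over adjacent $u,u'$. Let $F=[F_1,\dots,F_m]$ have $m$ inputs and $p$ outputs, and let $G=\mathrm{diag}(G_{11},\dots,G_{mm})$ be a diagonal pre-filter. For a causal left inverse $L$ of $G$, the zero-forcing equalization (ZFE) mechanism publishes $\hat y=FL(Gu+w)$, where $w$ is a Gaussian white noise with covariance matrix $\kappa_{\delta,\epsilon}^2(\Delta_2G)^2I_m$, in place of $y=Fu$. Its mean-square error is $e^{ZFE}_{mse}(G)=\lim_{T\to\infty}\frac1T\sum_{t=0}^{T-1}\mathbb E\bigl[|y_t-\hat y_t|_2^2\bigr]\in[0,\infty]$. **Theorem.** Suppose $\|F\|_2<\infty$, and put $$B=\kappa_{\delta,\epsilon}^2\Bigl(\frac1{2\pi}\int_{-\pi}^{\pi}\sum_{i=1}^m k_i\,|F_i(e^{j\omega})|_2\,d\omega\Bigr)^2 .$$ 1. For every stable diagonal $G$ with a causal left inverse $L$, the limit $e^{ZFE}_{mse}(G)$ exists in $[0,\infty]$, is the same for all input signals $u$, and satisfies $e^{ZFE}_{mse}(G)\ge B$. 2. For every stable diagonal $G$ with all $G_{ii}\ne0$, whether or not its inverse is causal, the frequency-domain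 expression of the mean-square error satisfies $$\kappa_{\delta,\epsilon}^2\,\|GK\|_2^2\,\|FG^{-1}\|_2^2\ \ge\ B,\qquad \|FG^{-1}\|_2^2:=\frac1{2\pi}\int_{-\pi}^{\pi}\sum_{i=1}^m\frac{|F_i(e^{j\omega})|_2^2}{|G_{ii}(e^{j\omega})|^2}\,d\omega\in[0,\infty],$$ where $0/0=0$ and $a/0=\infty$ for $a>0$. 3. If moreover each $F_i$ satisfies the Paley–Wiener condition $\frac1{2\pi}\int_{-\pi}^{\pi}\ln|F_i(e^{j\omega})|_2\,d\omega>-\infty$, then there are stable minimum phase (that is, outer) systems $G_{11},\dots,G_{mm}$ with $|G_{ii}(e^{j\omega})|^2=\frac1{k_i}|F_i(e^{j\omega})|_2$ for almost every $\omega\in[-\pi,\pi)$, such that $G=\mathrm{diag}(G_{11},\dots,G_{mm})$ has a causal left inverse and $e^{ZFE}_{mse}(G)=B$; the frequency-domain expression of item 2 is also equal to $B$. Here a stable scalar system $g$ is outer if $g(z)\neq0$ for $|z|>1$, $\ln|g(e^{j\omega})|$ is integrable, and for all $|z|>1$, $\ln|g(z)|=\frac1{2\pi}\int_{-\pi}^{\pi}\frac{|z|^2-1}{|z-e^{j\omega}|^2}\ln|g(e^{j\omega})|\,d\omega$.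 -/

import Mathlib

open Real Filter Topology MeasureTheory ProbabilityTheory
open scoped ENNReal NNReal

namespace ZFE

/-! ### Discrete-time signals and causal linear time-invariant systems -/

/-- A signal with values in `ℝ^m`, indexed by the times `t = 0, 1, 2, …`. -/
abbrev Signal (m : ℕ) := ℕ → Fin m → ℝ

/-- A causal LTI system with `m` inputs and `p` outputs and real coefficients, given by its
impulse response: its transfer matrix is `∑ t, F t * z ^ (-t)`. -/
abbrev LTI (m p : ℕ) := ℕ → Matrix (Fin p) (Fin m) ℝ

/-- The output `F u` of the system `F` driven by the signal `u`, starting at rest. -/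
def LTI.apply {m p : ℕ} (F : LTI m p) (u : Signal m) : Signal p :=
  fun t => ∑ s ∈ Finset.HasAntidiagonal.antidiagonal t, (F s.1).mulVec (u s.2)

/-- The series connection `A B` (first `B`, then `A`): the product of the transfer matrices. -/
def LTI.comp {m q p : ℕ} (A : LTI q p) (B : LTI m q) : LTI m p :=
  fun t => ∑ s ∈ Finset.HasAntidiagonal.antidiagonal t, A s.1 * B s.2

/-- The identity system, with transfer matrix `I`. -/
def LTI.id (m : ℕ) : LTI m m := fun t => if t = 0 then 1 else 0

/-- The diagonal system `diag(G₁₁, …, G_mm)` with scalar impulse responses `g i`. -/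
def LTI.diag {m : ℕ} (g : Fin m → ℕ → ℝ) : LTI m m :=
  fun t => Matrix.diagonal (fun i => g i t)

/-- The system `F K` with `K = diag(k₁, …, k_m)`. -/
def LTI.scale {m p : ℕ} (F : LTI m p) (k : Fin m → ℝ) : LTI m p :=
  fun t => F t * Matrix.diagonal k

/-- The squared Euclidean norm of a vector, as an extended nonnegative real. -/
noncomputable def sqNorm {p : ℕ} (x : Fin p → ℝ) : ℝ≥0∞ := ∑ j, ENNReal.ofReal (x j ^ 2)

/-- The `ℓ₂` norm of a signal, possibly infinite. -/
noncomputable def l2Norm {p : ℕ} (y : Signal p) : ℝ≥0∞ := (∑' t, sqNorm (y t)) ^ (1 / 2 : ℝ)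

/-- The squared `H₂` norm of a system: the sum over the inputs `i` of the energy of the `i`-th
column of its impulse response. -/
noncomputable def LTI.h2NormSq {m p : ℕ} (F : LTI m p) : ℝ≥0∞ :=
  ∑ i, ∑' t, sqNorm (fun j => F t j i)

/-- Stability of a causal system, in the `H₂` sense. -/
def LTI.IsStable {m p : ℕ} (G : LTI m p) : Prop := G.h2NormSq < ∞

/-! ### The unit circle -/

instance factTwoPiPos : Fact (0 < 2 * π) := ⟨Real.two_pi_pos⟩

/-- Frequencies `ω`, modulo `2π`. The probability measure `AddCircle.haarAddCircle` on it is
`dω / (2π)` on `[-π, π)`. -/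
abbrev Freq := AddCircle (2 * π)

/-- The normalized measure `dω / (2π)`. -/
noncomputable abbrev freqMeasure : Measure Freq := AddCircle.haarAddCircle

/-- The frequency response `ω ↦ g(e^{jω}) = ∑ t, g t * e^{-jωt}` of a square-summable scalar impulse
response, the series being summed in `L²(dω / (2π))`. -/
noncomputable def freqResponse (g : ℕ → ℝ) : Lp ℂ 2 freqMeasure :=
  ∑' t : ℕ, (g t : ℂ) • fourierLp 2 (-(t : ℤ))

/-- The Euclidean norm `|F_i(e^{jω})|₂` of the `i`-th column of the frequency response of `F`. -/
noncomputable def LTI.colNorm {m p : ℕ} (F : LTI m p) (i : Fin m) (ω : Freq) : ℝ :=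
  √(∑ j, ‖freqResponse (fun t => F t j i) ω‖ ^ 2)

/-- The condition `(1/2π) ∫ ln |F_i(e^{jω})|₂ dω > -∞`: the logarithm is finite almost everywhere
and integrable. -/
def LTI.PaleyWiener {m p : ℕ} (F : LTI m p) (i : Fin m) : Prop :=
  (∀ᵐ ω ∂freqMeasure, F.colNorm i ω ≠ 0) ∧
    Integrable (fun ω => Real.log (F.colNorm i ω)) freqMeasure

/-- The transfer function `∑ t, g t * z ^ (-t)` of a scalar system, for `1 < ‖z‖`. -/
noncomputable def transfer (g : ℕ → ℝ) (z : ℂ) : ℂ := ∑' t : ℕ, (g t : ℂ) * (z⁻¹) ^ t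

/-- A stable scalar system is minimum phase (outer) if its transfer function has no zero outside
the closed unit disc and `log |g(z)|` is there the Poisson integral of `log |g(e^{jω})|`. -/
def IsMinimumPhase (g : ℕ → ℝ) : Prop :=
  Integrable (fun ω => Real.log ‖freqResponse g ω‖) freqMeasure ∧
    ∀ z : ℂ, 1 < ‖z‖ → transfer g z ≠ 0 ∧
      Real.log ‖transfer g z‖ =
        ∫ ω, (‖z‖ ^ 2 - 1) / ‖z - (AddCircle.toCircle ω : ℂ)‖ ^ 2 *
          Real.log ‖freqResponse g ω‖ ∂freqMeasure

/-! ### Adjacency, sensitivity and the level of the privacy-preserving noise -/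

/-- Two signals are adjacent if they differ in each component `i` at one time at most, and there
by at most `k i`. -/
def Adj {m : ℕ} (k : Fin m → ℝ) (u u' : Signal m) : Prop :=
  ∀ i, ∃ (t₀ : ℕ) (α : ℝ), |α| ≤ k i ∧ ∀ t, u' t i - u t i = if t = t₀ then α else 0

/-- The `ℓ₂`-sensitivity of `G` with respect to the adjacency relation. -/
noncomputable def LTI.sensitivity {m p : ℕ} (G : LTI m p) (k : Fin m → ℝ) : ℝ≥0∞ :=
  ⨆ (u : Signal m) (u' : Signal m) (_ : Adj k u u'), l2Norm (G.apply u - G.apply u')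

/-- The Gaussian tail function `Q(x) = (2π)^(-1/2) ∫_x^∞ e^{-u²/2} du`, a decreasing bijection from
`ℝ` onto `(0, 1)`. -/
noncomputable def gaussianQ (x : ℝ) : ℝ :=
  1 / √(2 * π) * ∫ u in Set.Ioi x, Real.exp (-u ^ 2 / 2)

/-- `κ_{δ,ε} = (K + √(K² + 2ε)) / (2ε)` with `K = Q⁻¹(δ)`. -/
noncomputable def kappa (δ ε : ℝ) : ℝ :=
  1 / (2 * ε) * (Function.invFun gaussianQ δ + √(Function.invFun gaussianQ δ ^ 2 + 2 * ε))

/-- The law of an `m`-dimensional Gaussian white noise with covariance matrix `v • I`: all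
components at all times are independent, centred, of variance `v`. -/
noncomputable def whiteNoise (m : ℕ) (v : ℝ≥0) : Measure (Signal m) :=
  Measure.infinitePi fun _ : ℕ => Measure.pi fun _ : Fin m => gaussianReal 0 v

/-! ### The zero-forcing equalization mechanism -/

/-- The variance `κ² Δ²` of the noise added to the output of the pre-filter `G`, where `Δ` is the
`ℓ₂`-sensitivity of `G`. -/
noncomputable def noiseVar {m q : ℕ} (G : LTI m q) (k : Fin m → ℝ) (δ ε : ℝ) : ℝ≥0 :=
  Real.toNNReal ((kappa δ ε * (G.sensitivity k).toReal) ^ 2)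

/-- The published signal `F L (G u + w)`, for the noise signal `w`. -/
def published {m q p : ℕ} (F : LTI m p) (G : LTI m q) (L : LTI q m) (u : Signal m) (w : Signal q) :
    Signal p :=
  F.apply (L.apply (G.apply u + w))

/-- The mean-square error of the mechanism averaged over the first `T` times:
`(1/T) ∑_{t<T} E |(F u)_t - ŷ_t|₂²`. -/
noncomputable def avgError {m q p : ℕ} (F : LTI m p) (G : LTI m q) (L : LTI q m) (k : Fin m → ℝ)
    (δ ε : ℝ) (u : Signal m) (T : ℕ) : ℝ≥0∞ :=
  (∑ t ∈ Finset.range T,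
    ∫⁻ w, sqNorm (F.apply u t - published F G L u w t) ∂(whiteNoise q (noiseVar G k δ ε))) / T

/-- `e` is the mean-square error `lim_{T → ∞} (1/T) ∑_{t<T} E |(F u)_t - ŷ_t|₂²` of the mechanism,
whatever the input signal `u`. -/
def IsMSE {m q p : ℕ} (F : LTI m p) (G : LTI m q) (L : LTI q m) (k : Fin m → ℝ)
    (δ ε : ℝ) (e : ℝ≥0∞) : Prop :=
  ∀ u : Signal m, Tendsto (avgError F G L k δ ε u) atTop (𝓝 e)

/-- The frequency-domain expression `κ² ‖G K‖₂² ‖F G⁻¹‖₂²` of the mean-square error for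
`G = diag(G₁₁, …, G_mm)`, where
`‖F G⁻¹‖₂² = (1/2π) ∫ ∑_i |F_i(e^{jω})|₂² / |G_ii(e^{jω})|² dω`, with values in `[0, ∞]`. It makes
sense whether or not `G⁻¹` is causal. -/
noncomputable def freqError {m p : ℕ} (F : LTI m p) (g : Fin m → ℕ → ℝ) (k : Fin m → ℝ)
    (δ ε : ℝ) : ℝ≥0∞ :=
  ENNReal.ofReal (kappa δ ε ^ 2) * ((LTI.diag g).scale k).h2NormSq *
    ∫⁻ ω, ∑ i, ENNReal.ofReal (F.colNorm i ω ^ 2) /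
      ENNReal.ofReal (‖freqResponse (g i) ω‖ ^ 2) ∂freqMeasure

/-- The bound `κ² ((1/2π) ∫ ∑_i k_i |F_i(e^{jω})|₂ dω)²`. -/
noncomputable def errorBound {m p : ℕ} (F : LTI m p) (k : Fin m → ℝ) (δ ε : ℝ) : ℝ :=
  kappa δ ε ^ 2 * (∫ ω, ∑ i, k i * F.colNorm i ω ∂freqMeasure) ^ 2

end ZFE

/-!
The output error of the mechanism does not depend on the input: since `L G = I`, it is the noise
filtered by `F L`, so its time average tends to `v ‖F L‖₂²`, where `v` is the noise variance. For a
diagonal `G` the worst adjacent pair of signals consists of impulses of sizes `k i`, so the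
sensitivity is `‖G K‖₂` and the mean-square error is `κ² ‖G K‖₂² ‖F L‖₂²` (`isMSE_h2NormSq`,
`noiseVar_diag`).

**Lower bounds.** On the unit circle `|F_i| = |G_ii| |(F L)_i|`, because the frequency response of a
convolution of square-summable sequences is the product of the frequency responses
(`freqResponse_conv`). The Cauchy–Schwarz inequality applied to `k i |G_ii|` and `|(F L)_i|`, or
`|F_i| / |G_ii|` in the frequency domain, gives both bounds (`errorBound_le`).

**Attainment.** Equality holds if `k i |G_ii|² = |F_i|`. For an even `u` with `u` and `exp (2 u)`
integrable, the outer function of modulus `exp u` is the exponential of the Herglotz integral of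
`u` (`outerCoeff`). Jensen's inequality for the Poisson kernel makes it square summable, and the
`L¹` convergence of Poisson integrals identifies its boundary modulus
(`norm_freqResponse_outerCoeff`). Its formal inverse is the outer function of `-u`, which is causal
but possibly not stable. What has to be seen is that `F L` nevertheless has no more energy than
`|F_i|² / |G_ii|²` has integral. That is clear when `1 / G_ii` is bounded; the general case follows
by truncating `-u` from above and passing to the limit in each coefficient
(`tsum_conv_outerCoeff_neg_le`).
-/

namespace ZFE

/-! ### Series connections of causal systems -/

/-- The convolution of two scalar impulse responses: the product of the transfer functions. -/
def conv (a b : ℕ → ℝ) (t : ℕ) : ℝ := ∑ s ∈ Finset.HasAntidiagonal.antidiagonal t, a s.1 * b s.2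

theorem conv_comm (a b : ℕ → ℝ) : conv a b = conv b a := by
  funext t
  rw [conv, conv, ← Finset.Nat.sum_antidiagonal_swap]
  simp [mul_comm]

theorem sum_antidiagonal_assoc {N : Type*} [AddCommMonoid N] (f : ℕ → ℕ → ℕ → N) (t : ℕ) :
    ∑ s ∈ Finset.HasAntidiagonal.antidiagonal t,
        ∑ r ∈ Finset.HasAntidiagonal.antidiagonal s.1, f r.1 r.2 s.2 =
      ∑ s ∈ Finset.HasAntidiagonal.antidiagonal t,
        ∑ r ∈ Finset.HasAntidiagonal.antidiagonal s.2, f s.1 r.1 r.2 := by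
  simp only [Finset.sum_sigma']
  apply Finset.sum_nbij' (fun x => ⟨(x.2.1, x.2.2 + x.1.2), (x.2.2, x.1.2)⟩)
    (fun x => ⟨(x.1.1 + x.2.1, x.2.2), (x.1.1, x.2.1)⟩)
  · rintro ⟨⟨a, b⟩, ⟨c, d⟩⟩
    simp only [Finset.mem_sigma, Finset.HasAntidiagonal.mem_antidiagonal]
    grind
  · rintro ⟨⟨a, b⟩, ⟨c, d⟩⟩
    simp only [Finset.mem_sigma, Finset.HasAntidiagonal.mem_antidiagonal]
    grind
  · rintro ⟨⟨a, b⟩, ⟨c, d⟩⟩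
    simp only [Finset.mem_sigma, Finset.HasAntidiagonal.mem_antidiagonal]
    rintro ⟨h1, rfl⟩
    rfl
  · rintro ⟨⟨a, b⟩, ⟨c, d⟩⟩
    simp only [Finset.mem_sigma, Finset.HasAntidiagonal.mem_antidiagonal]
    rintro ⟨h1, rfl⟩
    rfl
  · intros
    rfl

namespace LTI

variable {l m n p : ℕ}

theorem comp_assoc (A : LTI n p) (B : LTI m n) (C : LTI l m) :
    (A.comp B).comp C = A.comp (B.comp C) := by
  funext t
  simp only [comp, Matrix.sum_mul, Matrix.mul_sum, Matrix.mul_assoc]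
  exact sum_antidiagonal_assoc (fun a b c => A a * (B b * C c)) t

theorem apply_comp (A : LTI n p) (B : LTI m n) (u : Signal m) :
    (A.comp B).apply u = A.apply (B.apply u) := by
  funext t
  simp only [comp, apply, Matrix.sum_mulVec, Matrix.mulVec_sum, Matrix.mulVec_mulVec]
  exact sum_antidiagonal_assoc (fun a b c => (A a * B b).mulVec (u c)) t

theorem comp_id (A : LTI m p) : A.comp (LTI.id m) = A := by
  funext t
  rw [comp, Finset.sum_eq_single (t, 0)]
  · simp [LTI.id]
  · rintro ⟨a, b⟩ h hne
    have hb : b ≠ 0 := by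
      rintro rfl
      simp at h
      simp [h] at hne
    simp [LTI.id, hb]
  · simp

theorem apply_add (A : LTI m p) (u v : Signal m) : A.apply (u + v) = A.apply u + A.apply v := by
  funext t
  simp [apply, Matrix.mulVec_add, Finset.sum_add_distrib]

theorem apply_sub (A : LTI m p) (u v : Signal m) : A.apply (u - v) = A.apply u - A.apply v := by
  funext t
  simp [apply, Matrix.mulVec_sub, Finset.sum_sub_distrib]

theorem comp_diag_apply (A : LTI m p) (g : Fin m → ℕ → ℝ) (t : ℕ) (j : Fin p) (i : Fin m) :
    A.comp (diag g) t j i = conv (fun s => A s j i) (g i) t := by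
  simp [comp, diag, conv, Matrix.sum_apply, Matrix.mul_diagonal]

theorem diag_apply (g : Fin m → ℕ → ℝ) (u : Signal m) (t : ℕ) (i : Fin m) :
    (diag g).apply u t i = conv (g i) (fun s => u s i) t := by
  simp [apply, diag, conv, Finset.sum_apply, Matrix.mulVec_diagonal]

theorem h2NormSq_scale_diag (g : Fin m → ℕ → ℝ) (k : Fin m → ℝ) :
    ((diag g).scale k).h2NormSq =
      ∑ i, ENNReal.ofReal (k i ^ 2) * ∑' t, ENNReal.ofReal (g i t ^ 2) := by
  refine Finset.sum_congr rfl fun i _ => ?_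
  rw [← ENNReal.tsum_mul_left]
  refine tsum_congr fun t => ?_
  rw [sqNorm, Finset.sum_eq_single i]
  · rw [← ENNReal.ofReal_mul (sq_nonneg _)]
    simp [scale, diag, mul_pow, mul_comm]
  · intro j _ hj
    simp [scale, diag, Matrix.diagonal_apply_ne _ hj]
  · simp

theorem h2NormSq_diag (g : Fin m → ℕ → ℝ) :
    (diag g).h2NormSq = ∑ i, ∑' t, ENNReal.ofReal (g i t ^ 2) := by
  have h : (diag g).scale 1 = diag g := by
    funext t
    rw [scale, show (Matrix.diagonal (1 : Fin m → ℝ)) = 1 from Matrix.diagonal_one, mul_one]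
  simpa [h] using h2NormSq_scale_diag g 1

theorem tsum_sqNorm_comm {q : ℕ} (y : Signal q) :
    ∑' t, sqNorm (y t) = ∑ j, ∑' t, ENNReal.ofReal (y t j ^ 2) := by
  simp only [sqNorm]
  exact Summable.tsum_finsetSum fun _ _ => ENNReal.summable

theorem h2NormSq_eq (F : LTI m p) :
    F.h2NormSq = ∑ i, ∑ j, ∑' t, ENNReal.ofReal (F t j i ^ 2) :=
  Finset.sum_congr rfl fun i _ => tsum_sqNorm_comm fun t j => F t j i

end LTI

/-! ### The sensitivity of a diagonal system -/

theorem tsum_conv_impulse_sq (g : ℕ → ℝ) (t₀ : ℕ) (α : ℝ) :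
    ∑' t, ENNReal.ofReal (conv g (fun s => if s = t₀ then α else 0) t ^ 2) =
      ENNReal.ofReal (α ^ 2) * ∑' t, ENNReal.ofReal (g t ^ 2) := by
  have h1 (t : ℕ) : conv g (fun s => if s = t₀ then α else 0) (t + t₀) = α * g t := by
    rw [conv, Finset.sum_eq_single (t, t₀)]
    · simp [mul_comm]
    · rintro ⟨a, b⟩ h hne
      have : b ≠ t₀ := by
        rintro rfl
        simp at h
        simp [h] at hne
      simp [this]
    · simp
  have h2 (t : ℕ) (ht : t < t₀) : conv g (fun s => if s = t₀ then α else 0) t = 0 := by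
    rw [conv]
    refine Finset.sum_eq_zero ?_
    rintro ⟨a, b⟩ h
    have : b ≠ t₀ := by simp at h; omega
    simp [this]
  rw [← ENNReal.summable.sum_add_tsum_nat_add' (k := t₀), Finset.sum_eq_zero, zero_add,
    ← ENNReal.tsum_mul_left]
  · refine tsum_congr fun t => ?_
    rw [h1, mul_pow, ENNReal.ofReal_mul (sq_nonneg _)]
  · intro t ht
    rw [h2 t (by simpa using ht)]
    simp

/-- The supremum defining the sensitivity of a diagonal system is attained by impulses of the
largest admissible sizes. -/
theorem sensitivity_diag {m : ℕ} (g : Fin m → ℕ → ℝ) (k : Fin m → ℝ) (hk : ∀ i, 0 < k i) :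
    (LTI.diag g).sensitivity k = (((LTI.diag g).scale k).h2NormSq) ^ (1 / 2 : ℝ) := by
  have key (u u' : Signal m) (t₀ : Fin m → ℕ) (α : Fin m → ℝ)
      (h : ∀ i t, u' t i - u t i = if t = t₀ i then α i else 0) :
      l2Norm ((LTI.diag g).apply u - (LTI.diag g).apply u') =
        (∑ i, ENNReal.ofReal (α i ^ 2) * ∑' t, ENNReal.ofReal (g i t ^ 2)) ^ (1 / 2 : ℝ) := by
    rw [l2Norm, ← LTI.apply_sub, LTI.tsum_sqNorm_comm]
    congr 1
    refine Finset.sum_congr rfl fun i _ => ?_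
    rw [show α i ^ 2 = (-α i) ^ 2 by ring, ← tsum_conv_impulse_sq (g i) (t₀ i)]
    refine tsum_congr fun t => ?_
    rw [LTI.diag_apply]
    congr 3
    funext s
    have := h i s
    simp only [Pi.sub_apply]
    split_ifs at this ⊢ <;> linarith
  rw [LTI.h2NormSq_scale_diag]
  apply le_antisymm
  · refine iSup_le fun u => iSup_le fun u' => iSup_le fun h => ?_
    choose t₀ α hα h using h
    rw [key u u' t₀ α h]
    gcongr ?_ ^ _
    refine Finset.sum_le_sum fun i _ => ?_
    gcongr ENNReal.ofReal ?_ * _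
    exact sq_le_sq' (neg_le_of_abs_le (hα i)) (le_of_abs_le (hα i))
  · refine le_trans (le_of_eq ?_) (le_iSup_of_le (0 : Signal m) (le_iSup_of_le
      (fun t i => if t = 0 then k i else 0) (le_iSup_of_le (fun i => ⟨0, k i, ?_, ?_⟩) le_rfl)))
    · exact (key _ _ (fun _ => 0) k (by simp)).symm
    · rw [abs_of_pos (hk i)]
    · simp

/-- The noise variance of a stable diagonal pre-filter. Stability matters: an infinite sensitivity
would be turned into `0` by `toReal`. -/
theorem noiseVar_diag {m : ℕ} (g : Fin m → ℕ → ℝ) (k : Fin m → ℝ) (hk : ∀ i, 0 < k i)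
    (hg : (LTI.diag g).IsStable) (δ ε : ℝ) :
    (noiseVar (LTI.diag g) k δ ε : ℝ≥0∞) =
      ENNReal.ofReal (kappa δ ε ^ 2) * ((LTI.diag g).scale k).h2NormSq := by
  have hfin : ((LTI.diag g).scale k).h2NormSq ≠ ∞ := by
    rw [LTI.IsStable, LTI.h2NormSq_diag] at hg
    rw [LTI.h2NormSq_scale_diag]
    refine (ENNReal.sum_lt_top.2 fun i _ => ?_).ne
    exact ENNReal.mul_lt_top ENNReal.ofReal_lt_top
      ((Finset.single_le_sum (f := fun i => ∑' t, ENNReal.ofReal (g i t ^ 2))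
        (fun _ _ => zero_le) (Finset.mem_univ i)).trans_lt hg)
  change ENNReal.ofReal _ = _
  rw [sensitivity_diag g k hk, mul_pow, ENNReal.ofReal_mul (sq_nonneg _), ← ENNReal.toReal_pow,
    ENNReal.ofReal_toReal, ← ENNReal.rpow_natCast, ← ENNReal.rpow_mul]
  · norm_num
  · exact ENNReal.pow_ne_top (ENNReal.rpow_ne_top_of_nonneg (by norm_num) hfin)

/-! ### The mean-square error as an `H₂` norm -/

instance (m : ℕ) (v : ℝ≥0) : IsProbabilityMeasure (whiteNoise m v) := by
  unfold whiteNoise; infer_instance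

/-- A linear functional of white noise has the variance expected from independence. -/
theorem lintegral_whiteNoise_sq {m : ℕ} (v : ℝ≥0) (S : Finset ℕ) (h : ℕ → Fin m → ℝ) :
    ∫⁻ w, ENNReal.ofReal ((∑ t ∈ S, ∑ i, h t i * w t i) ^ 2) ∂(whiteNoise m v) =
      v * ∑ t ∈ S, ∑ i, ENNReal.ofReal (h t i ^ 2) := by
  have hX1 (t : ℕ) (i : Fin m) : MemLp (fun x : ℝ => h t i * x) 2 (gaussianReal 0 v) :=
    (memLp_id_gaussianReal 2).const_mul (h t i)
  have hY1 (t : ℕ) : MemLp (fun x : Fin m → ℝ => ∑ i, h t i * x i) 2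
      (Measure.pi fun _ : Fin m => gaussianReal 0 v) :=
    memLp_finsetSum _ fun i _ => (hX1 t i).comp_measurePreserving (measurePreserving_eval _ i)
  have hvY (t : ℕ) : Var[fun x : Fin m → ℝ => ∑ i, h t i * x i;
      Measure.pi fun _ : Fin m => gaussianReal 0 v] = ∑ i, h t i ^ 2 * v := by
    have := variance_sum_pi (μ := fun _ : Fin m => gaussianReal 0 v)
      (X := fun i x => h t i * x) (hX1 t)
    rw [Finset.sum_fn] at this
    rw [this]
    refine Finset.sum_congr rfl fun i _ => ?_
    rw [variance_const_mul, variance_fun_id_gaussianReal]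
  have hmY (t : ℕ) : ∫ x : Fin m → ℝ, ∑ i, h t i * x i
      ∂(Measure.pi fun _ : Fin m => gaussianReal 0 v) = 0 := by
    rw [integral_finsetSum]
    · refine Finset.sum_eq_zero fun i _ => ?_
      rw [integral_const_mul]
      have := integral_comp_eval (μ := fun _ : Fin m => gaussianReal 0 v) (i := i)
        (f := fun x : ℝ => x) (by fun_prop)
      rw [this, integral_id_gaussianReal, mul_zero]
    · intro i _
      exact ((hX1 t i).comp_measurePreserving (measurePreserving_eval _ i)).integrable
        (by norm_num)
  have hmp (t : ℕ) : MeasurePreserving (fun w : Signal m => w t) (whiteNoise m v)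
      (Measure.pi fun _ : Fin m => gaussianReal 0 v) := measurePreserving_eval_infinitePi _ t
  have hZ (t : ℕ) : MemLp (fun w : Signal m => ∑ i, h t i * w t i) 2 (whiteNoise m v) :=
    (hY1 t).comp_measurePreserving (hmp t)
  have hvZ (t : ℕ) : Var[fun w : Signal m => ∑ i, h t i * w t i; whiteNoise m v] =
      ∑ i, h t i ^ 2 * v := by
    rw [← hvY t]
    conv_rhs => rw [← (hmp t).map_eq]
    rw [variance_map]
    · rfl
    · exact Measurable.aemeasurable (by fun_prop)
    · exact (hmp t).measurable.aemeasurable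
  have hmZ (t : ℕ) : ∫ w : Signal m, ∑ i, h t i * w t i ∂(whiteNoise m v) = 0 := by
    rw [← hmY t, ← (hmp t).map_eq, integral_map (hmp t).measurable.aemeasurable]
    exact Measurable.aestronglyMeasurable (by fun_prop)
  have hind : Set.Pairwise (S : Set ℕ) fun s t =>
      IndepFun (fun w : Signal m => ∑ i, h s i * w s i) (fun w : Signal m => ∑ i, h t i * w t i)
        (whiteNoise m v) := by
    intro s _ t _ hst
    exact (iIndepFun_infinitePi (P := fun _ : ℕ => Measure.pi fun _ : Fin m => gaussianReal 0 v)
      (X := fun t (x : Fin m → ℝ) => ∑ i, h t i * x i) (by fun_prop)).indepFun hst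
  have hvar := IndepFun.variance_sum (fun t _ => hZ t) hind
  rw [Finset.sum_fn, variance_of_integral_eq_zero] at hvar
  · rw [← ofReal_integral_eq_lintegral_ofReal]
    · rw [hvar, ENNReal.ofReal_sum_of_nonneg, Finset.mul_sum]
      · refine Finset.sum_congr rfl fun t _ => ?_
        rw [hvZ, ENNReal.ofReal_sum_of_nonneg (fun i _ => by positivity), Finset.mul_sum]
        refine Finset.sum_congr rfl fun i _ => ?_
        rw [mul_comm, ENNReal.ofReal_mul (by positivity), ENNReal.ofReal_coe_nnreal]
      · intro t _
        exact variance_nonneg _ _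
    · exact (memLp_finsetSum _ fun t _ => hZ t).integrable_sq
    · exact Eventually.of_forall fun _ => sq_nonneg _
  · exact Measurable.aemeasurable (by fun_prop)
  · rw [integral_finsetSum _ fun t _ => (hZ t).integrable (by norm_num)]
    exact Finset.sum_eq_zero fun t _ => hmZ t

/-- The error at time `t` is the noise filtered by `F L`. -/
theorem lintegral_error {m q p : ℕ} (F : LTI m p) (G : LTI m q) (L : LTI q m)
    (hL : L.comp G = LTI.id m) (u : Signal m) (v : ℝ≥0) (t : ℕ) :
    ∫⁻ w, sqNorm (F.apply u t - published F G L u w t) ∂(whiteNoise q v) =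
      v * ∑ s ∈ Finset.range (t + 1), ∑ i, sqNorm (fun j => F.comp L s j i) := by
  have h1 (w : Signal q) : F.apply u t - published F G L u w t = -(F.comp L).apply w t := by
    rw [published, LTI.apply_add, LTI.apply_add, ← LTI.apply_comp L G, hL, ← LTI.apply_comp F,
      ← LTI.apply_comp F, LTI.comp_id]
    simp
  have h2 (w : Signal q) (j : Fin p) : (F.comp L).apply w t j =
      ∑ s ∈ Finset.range (t + 1), ∑ i, F.comp L (t - s) j i * w s i := by
    rw [LTI.apply, ← Finset.Nat.sum_antidiagonal_swap,
      Finset.Nat.sum_antidiagonal_eq_sum_range_succ_mk]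
    simp [Matrix.mulVec, dotProduct]
  simp_rw [h1, sqNorm, Pi.neg_apply, neg_sq, h2]
  rw [lintegral_finsetSum']
  · have h3 (j : Fin p) := lintegral_whiteNoise_sq v (Finset.range (t + 1))
      (fun s i => F.comp L (t - s) j i)
    refine (Finset.sum_congr rfl fun j _ => h3 j).trans ?_
    rw [← Finset.mul_sum]
    congr 1
    refine Eq.trans ?_ (Finset.sum_range_reflect
      (fun s => ∑ i, sqNorm fun j => F.comp L s j i) (t + 1))
    rw [Finset.sum_comm]
    refine Finset.sum_congr rfl fun s _ => ?_
    exact Finset.sum_comm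
  · intro j _
    exact Measurable.aemeasurable (by fun_prop)

/-- Cesàro means of an increasing sequence in `[0, ∞]` converge to its supremum. -/
theorem tendsto_cesaro_ennreal {a : ℕ → ℝ≥0∞} {l : ℝ≥0∞} (hle : ∀ n, a n ≤ l)
    (h : Tendsto a atTop (𝓝 l)) :
    Tendsto (fun T : ℕ => (∑ t ∈ Finset.range T, a t) / T) atTop (𝓝 l) := by
  have hup (T : ℕ) : (∑ t ∈ Finset.range T, a t) / T ≤ l := by
    refine ENNReal.div_le_of_le_mul ?_
    calc ∑ t ∈ Finset.range T, a t ≤ ∑ t ∈ Finset.range T, l := Finset.sum_le_sum fun t _ => hle t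
      _ = l * T := by simp [mul_comm]
  refine tendsto_order.2 ⟨fun b hb => ?_, fun b hb => Eventually.of_forall fun T =>
    (hup T).trans_lt hb⟩
  obtain ⟨c, hbc, hcl⟩ := ENNReal.lt_iff_exists_nnreal_btwn.1 hb
  have hmin : Tendsto (fun n => (min (a n) c).toReal) atTop (𝓝 c) := by
    have h1 : ∀ᶠ n in atTop, (min (a n) c).toReal = c := by
      filter_upwards [h.eventually_const_lt hcl] with n hn
      rw [min_eq_right hn.le, ENNReal.coe_toReal]
    exact tendsto_const_nhds.congr' (h1.mono fun _ h => h.symm)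
  have hlim := ENNReal.tendsto_ofReal hmin.cesaro
  rw [ENNReal.ofReal_coe_nnreal] at hlim
  filter_upwards [hlim.eventually_const_lt hbc, eventually_gt_atTop 0] with T hT hT0
  refine hT.trans_le ?_
  have hpos : (0 : ℝ) < T := by exact_mod_cast hT0
  rw [mul_comm, ← div_eq_mul_inv, ENNReal.ofReal_div_of_pos hpos, ENNReal.ofReal_natCast,
    ENNReal.ofReal_sum_of_nonneg fun _ _ => ENNReal.toReal_nonneg]
  gcongr with t
  rw [ENNReal.ofReal_toReal (ne_top_of_le_ne_top ENNReal.coe_ne_top (min_le_right _ _))]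
  exact min_le_left _ _

theorem isMSE_h2NormSq {m q p : ℕ} (F : LTI m p) (G : LTI m q) (L : LTI q m)
    (hL : L.comp G = LTI.id m) (k : Fin m → ℝ) (δ ε : ℝ) :
    IsMSE F G L k δ ε (noiseVar G k δ ε * (F.comp L).h2NormSq) := by
  intro u
  unfold avgError
  simp_rw [lintegral_error F G L hL]
  have hsum : (F.comp L).h2NormSq = ∑' t, ∑ i, sqNorm (fun j => F.comp L t j i) :=
    (Summable.tsum_finsetSum fun _ _ => ENNReal.summable).symm
  rw [hsum]
  refine tendsto_cesaro_ennreal (fun t => ?_) ?_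
  · gcongr
    exact ENNReal.sum_le_tsum _
  · refine ENNReal.Tendsto.const_mul ?_ (Or.inr ENNReal.coe_ne_top)
    exact ENNReal.summable.hasSum.tendsto_sum_nat.comp (tendsto_add_atTop_nat 1)

/-! ### Frequency responses of square-summable sequences -/

theorem tsum_ofReal_sq_lt_top_iff (g : ℕ → ℝ) :
    ∑' t, ENNReal.ofReal (g t ^ 2) < ∞ ↔ Summable fun t => g t ^ 2 := by
  constructor
  · intro h
    have := ENNReal.summable_toReal h.ne
    simpa [ENNReal.toReal_ofReal (sq_nonneg _)] using this
  · intro h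
    rw [← ENNReal.ofReal_tsum_of_nonneg (fun _ => sq_nonneg _) h]
    exact ENNReal.ofReal_lt_top

theorem LTI.IsStable.summable_diag {m : ℕ} {g : Fin m → ℕ → ℝ} (h : (LTI.diag g).IsStable)
    (i : Fin m) : Summable fun t => g i t ^ 2 := by
  rw [LTI.IsStable, LTI.h2NormSq_diag] at h
  exact (tsum_ofReal_sq_lt_top_iff _).1 (ENNReal.sum_lt_top.1 h i (Finset.mem_univ i))

theorem LTI.summable_of_h2NormSq_lt_top {m p : ℕ} {F : LTI m p} (h : F.h2NormSq < ∞)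
    (j : Fin p) (i : Fin m) : Summable fun t => F t j i ^ 2 := by
  rw [LTI.h2NormSq_eq] at h
  exact (tsum_ofReal_sq_lt_top_iff _).1
    (ENNReal.sum_lt_top.1 (ENNReal.sum_lt_top.1 h i (Finset.mem_univ i)) j (Finset.mem_univ j))

theorem hasSum_freqResponse {g : ℕ → ℝ} (hg : Summable fun t => g t ^ 2) :
    HasSum (fun t : ℕ => (g t : ℂ) • (fourierLp 2 (-(t : ℤ)) : Lp ℂ 2 freqMeasure))
      (freqResponse g) := by
  have ho : Orthonormal ℂ fun t : ℕ => (fourierLp 2 (-(t : ℤ)) : Lp ℂ 2 freqMeasure) :=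
    orthonormal_fourier.comp (fun t : ℕ => -(t : ℤ)) fun a b h => by simpa using h
  refine Summable.hasSum ?_
  refine (ho.orthogonalFamily.summable_iff_norm_sq_summable fun t => (g t : ℂ)).2 ?_
  simpa using hg

theorem freqResponse_sub {g h : ℕ → ℝ} (hg : Summable fun t => g t ^ 2)
    (hh : Summable fun t => h t ^ 2) (hgh : Summable fun t => (g t - h t) ^ 2) :
    freqResponse (fun t => g t - h t) = freqResponse g - freqResponse h := by
  refine (hasSum_freqResponse hgh).unique ?_
  refine ((hasSum_freqResponse hg).sub (hasSum_freqResponse hh)).congr_fun ?_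
  intro t
  rw [← sub_smul]
  push_cast
  rfl

theorem fourierCoeff_eq_inner (f : Lp ℂ 2 freqMeasure) (n : ℤ) :
    fourierCoeff f n = inner ℂ (fourierLp 2 n : Lp ℂ 2 freqMeasure) f := by
  rw [← fourierBasis_repr, HilbertBasis.repr_apply_apply, coe_fourierBasis]

theorem fourierCoeff_freqResponse {g : ℕ → ℝ} (hg : Summable fun t => g t ^ 2) (n : ℤ) :
    fourierCoeff (freqResponse g) n = if n ≤ 0 then (g n.natAbs : ℂ) else 0 := by
  have h := (hasSum_freqResponse hg).mapL (innerSL ℂ (fourierLp 2 n : Lp ℂ 2 freqMeasure))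
  rw [fourierCoeff_eq_inner]
  refine h.unique ?_
  have h1 (t : ℕ) : innerSL ℂ (fourierLp 2 n : Lp ℂ 2 freqMeasure)
      ((g t : ℂ) • (fourierLp 2 (-(t : ℤ)) : Lp ℂ 2 freqMeasure)) =
        if n = -t then (g t : ℂ) else 0 := by
    rw [innerSL_apply_apply, inner_smul_right, orthonormal_iff_ite.1 orthonormal_fourier]
    simp
  simp only [h1]
  split_ifs with hn
  · have h2 : (fun t : ℕ => if n = -t then (g t : ℂ) else 0) =
        fun t => if t = n.natAbs then (g n.natAbs : ℂ) else 0 := by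
      funext t
      by_cases ht : t = n.natAbs
      · subst ht
        rw [if_pos rfl, if_pos (by omega)]
      · rw [if_neg ht, if_neg (by omega)]
    rw [h2]
    exact hasSum_ite_eq _ _
  · have h2 : (fun t : ℕ => if n = -t then (g t : ℂ) else 0) = fun _ => 0 :=
      funext fun t => if_neg (by omega)
    rw [h2]
    exact hasSum_zero

theorem lintegral_enorm_sq_eq_tsum {f : Freq → ℂ} (hf : MemLp f 2 freqMeasure) :
    ∫⁻ ω, ‖f ω‖ₑ ^ 2 ∂freqMeasure = ∑' n : ℤ, ‖fourierCoeff f n‖ₑ ^ 2 := by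
  have h := hasSum_sq_fourierCoeff (hf.toLp f)
  have h1 (n : ℤ) : fourierCoeff (hf.toLp f) n = fourierCoeff f n :=
    congrFun (fourierCoeff_congr_ae hf.coeFn_toLp) n
  have h2 : ∫ ω, ‖hf.toLp f ω‖ ^ 2 ∂freqMeasure = ∫ ω, ‖f ω‖ ^ 2 ∂freqMeasure :=
    integral_congr_ae (hf.coeFn_toLp.mono fun ω h => by simp only [h])
  simp only [h1] at h
  have h3 : HasSum (fun n => ‖fourierCoeff f n‖ ^ 2) (∫ ω, ‖f ω‖ ^ 2 ∂freqMeasure) := by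
    rw [← h2]; exact h
  have h4 : ∫⁻ ω, ENNReal.ofReal (‖f ω‖ ^ 2) ∂freqMeasure =
      ENNReal.ofReal (∑' n, ‖fourierCoeff f n‖ ^ 2) := by
    rw [h3.tsum_eq, ofReal_integral_eq_lintegral_ofReal]
    · exact hf.integrable_norm_pow (by norm_num)
    · exact Eventually.of_forall fun _ => sq_nonneg _
  rw [ENNReal.ofReal_tsum_of_nonneg (fun _ => sq_nonneg _) h3.summable] at h4
  simpa only [ENNReal.ofReal_pow (norm_nonneg _), ofReal_norm] using h4

/-- Bessel's inequality for the frequencies `0, -1, -2, …`. -/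
theorem tsum_enorm_fourierCoeff_neg_le {f : Freq → ℂ} (hf : MemLp f 2 freqMeasure) :
    ∑' t : ℕ, ‖fourierCoeff f (-(t : ℤ))‖ₑ ^ 2 ≤ ∫⁻ ω, ‖f ω‖ₑ ^ 2 ∂freqMeasure := by
  rw [lintegral_enorm_sq_eq_tsum hf]
  exact ENNReal.tsum_comp_le_tsum_of_injective (f := fun t : ℕ => -(t : ℤ))
    (fun a b h => by simpa using h) fun n => ‖fourierCoeff f n‖ₑ ^ 2

theorem enorm_ofReal_sq (x : ℝ) : ‖(x : ℂ)‖ₑ ^ 2 = ENNReal.ofReal (x ^ 2) := by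
  rw [← ofReal_norm, ← ENNReal.ofReal_pow (norm_nonneg _)]
  simp

theorem lintegral_freqResponse_sq {g : ℕ → ℝ} (hg : Summable fun t => g t ^ 2) :
    ∫⁻ ω, ‖freqResponse g ω‖ₑ ^ 2 ∂freqMeasure = ∑' t, ENNReal.ofReal (g t ^ 2) := by
  rw [lintegral_enorm_sq_eq_tsum (Lp.memLp _)]
  have hinj : Function.Injective fun t : ℕ => -(t : ℤ) := fun a b h => by simpa using h
  rw [← hinj.tsum_eq]
  · refine tsum_congr fun t => ?_
    rw [fourierCoeff_freqResponse hg, if_pos (by simp), ← enorm_ofReal_sq]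
    simp
  · intro n hn
    by_contra h
    have : ¬ n ≤ 0 := fun h0 => h ⟨n.natAbs, by dsimp only; omega⟩
    simp [fourierCoeff_freqResponse hg, this] at hn

/-- For an absolutely summable impulse response the `L²` sum is the pointwise sum. -/
theorem freqResponse_ae_eq_tsum {g : ℕ → ℝ} (hg : Summable fun t => |g t|)
    (hg2 : Summable fun t => g t ^ 2) :
    freqResponse g =ᵐ[freqMeasure] fun ω => ∑' t : ℕ, (g t : ℂ) * fourier (-(t : ℤ)) ω := by
  have hs : Summable fun t : ℕ => (g t : ℂ) • (fourier (-(t : ℤ)) : C(Freq, ℂ)) := by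
    refine Summable.of_norm ?_
    simpa [norm_smul, fourier_norm] using hg
  have h1 := hs.hasSum.mapL (ContinuousMap.toLp (E := ℂ) 2 freqMeasure ℂ)
  simp only [map_smul] at h1
  rw [(hasSum_freqResponse hg2).unique h1]
  refine (ContinuousMap.coeFn_toLp freqMeasure _).trans (Eventually.of_forall fun ω => ?_)
  have h2 := hs.hasSum.mapL (ContinuousMap.evalCLM ℂ ω)
  exact h2.tsum_eq.symm

/-! ### Poisson integrals on the unit circle -/

theorem integral_toCircle {E : Type*} [NormedAddCommGroup E] [NormedSpace ℝ E] (f : ℂ → E) :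
    ∫ ω : Freq, f (AddCircle.toCircle ω : ℂ) ∂freqMeasure = Real.circleAverage f 0 1 := by
  rw [AddCircle.integral_haarAddCircle, ← AddCircle.intervalIntegral_preimage (2 * π) 0,
    Real.circleAverage, zero_add]
  congr 1
  refine intervalIntegral.integral_congr fun θ _ => ?_
  simp only [circleMap, AddCircle.toCircle_apply_mk, Circle.coe_exp]
  congr 1
  simp

theorem fourier_natCast (n : ℕ) (ω : Freq) :
    (fourier (n : ℤ) ω : ℂ) = (AddCircle.toCircle ω : ℂ) ^ n := by
  rw [fourier_apply, natCast_zsmul, AddCircle.toCircle_nsmul, Circle.coe_pow]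

theorem norm_toCircle (ω : Freq) : ‖(AddCircle.toCircle ω : ℂ)‖ = 1 := Circle.norm_coe _

/-- The Poisson kernel of the point `w` of the unit disc, on the unit circle. -/
noncomputable def diskKernel (w : ℂ) (ω : Freq) : ℝ := poissonKernel 0 w (AddCircle.toCircle ω)

theorem diskKernel_eq (w : ℂ) (ω : Freq) :
    diskKernel w ω = (1 - ‖w‖ ^ 2) / ‖(AddCircle.toCircle ω : ℂ) - w‖ ^ 2 := by
  simp [diskKernel, poissonKernel, norm_toCircle]

theorem diskKernel_nonneg {w : ℂ} (hw : ‖w‖ < 1) (ω : Freq) : 0 ≤ diskKernel w ω := by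
  rw [diskKernel_eq]
  have : ‖w‖ ^ 2 < 1 := by nlinarith [norm_nonneg w]
  have : 0 < 1 - ‖w‖ ^ 2 := by linarith
  positivity

theorem toCircle_sub_ne_zero {w : ℂ} (hw : ‖w‖ < 1) (ω : Freq) :
    (AddCircle.toCircle ω : ℂ) - w ≠ 0 := by
  intro h
  rw [← sub_eq_zero.1 h, norm_toCircle] at hw
  exact hw.false

theorem continuous_toCircle : Continuous fun ω : Freq => (AddCircle.toCircle ω : ℂ) :=
  continuous_subtype_val.comp AddCircle.continuous_toCircle

theorem continuous_diskKernel {w : ℂ} (hw : ‖w‖ < 1) : Continuous (diskKernel w) := by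
  have h : diskKernel w = fun ω => (1 - ‖w‖ ^ 2) / ‖(AddCircle.toCircle ω : ℂ) - w‖ ^ 2 :=
    funext (diskKernel_eq w)
  rw [h]
  refine Continuous.div continuous_const ((continuous_toCircle.sub continuous_const).norm.pow 2)
    fun ω => ?_
  have := toCircle_sub_ne_zero hw ω
  positivity

theorem norm_mul_toCircle {r : ℝ} (hr : 0 ≤ r) (θ : Freq) :
    ‖(r : ℂ) * (AddCircle.toCircle θ : ℂ)‖ = r := by
  simp [abs_of_nonneg hr, norm_toCircle]

theorem continuous_diskKernel_prod {r : ℝ} (hr : 0 ≤ r) (hr1 : r < 1) :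
    Continuous fun x : Freq × Freq => diskKernel (r * (AddCircle.toCircle x.1 : ℂ)) x.2 := by
  simp only [diskKernel_eq, norm_mul_toCircle hr]
  refine Continuous.div continuous_const ((((continuous_toCircle.comp continuous_snd)).sub
    (continuous_const.mul (continuous_toCircle.comp continuous_fst))).norm.pow 2) fun x => ?_
  have := toCircle_sub_ne_zero (w := r * (AddCircle.toCircle x.1 : ℂ))
    (by rwa [norm_mul_toCircle hr]) x.2
  have : 0 < ‖(AddCircle.toCircle x.2 : ℂ) - r * (AddCircle.toCircle x.1 : ℂ)‖ :=
    norm_pos_iff.2 this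
  exact (pow_pos this 2).ne'

theorem diskKernel_symm {r : ℝ} (hr : 0 ≤ r) (θ ω : Freq) :
    diskKernel (r * (AddCircle.toCircle θ : ℂ)) ω =
      diskKernel (r * (AddCircle.toCircle ω : ℂ)) θ := by
  rw [diskKernel_eq, diskKernel_eq, norm_mul_toCircle hr, norm_mul_toCircle hr]
  congr 2
  have h (x : Freq) : (AddCircle.toCircle x : ℂ) *
      (starRingEnd ℂ) (AddCircle.toCircle x : ℂ) = 1 := by
    rw [Complex.mul_conj]
    simp
  have h1 : (AddCircle.toCircle ω : ℂ) - r * (AddCircle.toCircle θ : ℂ) =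
      (AddCircle.toCircle ω : ℂ) * (AddCircle.toCircle θ : ℂ) * (starRingEnd ℂ)
        ((AddCircle.toCircle θ : ℂ) - r * (AddCircle.toCircle ω : ℂ)) := by
    rw [map_sub, map_mul, Complex.conj_ofReal]
    linear_combination (-(AddCircle.toCircle ω : ℂ)) * h θ + r * (AddCircle.toCircle θ : ℂ) * h ω
  rw [h1, norm_mul, norm_mul, norm_toCircle, norm_toCircle, RCLike.norm_conj, one_mul, one_mul]

/-- The Poisson formula for `z ↦ z ^ n`. -/
theorem integral_diskKernel_fourier_nat {w : ℂ} (hw : ‖w‖ < 1) (n : ℕ) :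
    ∫ ω, diskKernel w ω • (fourier (n : ℤ) ω : ℂ) ∂freqMeasure = w ^ n := by
  simp only [fourier_natCast, diskKernel]
  rw [integral_toCircle fun z => poissonKernel 0 w z • z ^ n]
  exact DiffContOnCl.circleAverage_poissonKernel_smul (f := fun z => z ^ n)
    (Differentiable.diffContOnCl (by fun_prop)) (by simpa using hw)

theorem integral_diskKernel_fourier_neg {w : ℂ} (hw : ‖w‖ < 1) (n : ℕ) :
    ∫ ω, diskKernel w ω • (fourier (-(n : ℤ)) ω : ℂ) ∂freqMeasure = (starRingEnd ℂ w) ^ n := by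
  rw [← map_pow, ← integral_diskKernel_fourier_nat hw, ← integral_conj]
  refine integral_congr_ae (Eventually.of_forall fun ω => ?_)
  simp only [fourier_neg, Complex.real_smul, map_mul, Complex.conj_ofReal]

theorem integral_diskKernel {w : ℂ} (hw : ‖w‖ < 1) :
    ∫ ω, diskKernel w ω ∂freqMeasure = 1 := by
  have h := integral_diskKernel_fourier_nat hw 0
  simp only [CharP.cast_eq_zero, fourier_zero, Complex.real_smul, mul_one, pow_zero] at h
  rw [integral_complex_ofReal] at h
  exact_mod_cast h

theorem integrable_of_continuous {E : Type*} [NormedAddCommGroup E]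
    {f : Freq → E} (hf : Continuous f) : Integrable f freqMeasure :=
  hf.integrable_of_hasCompactSupport (HasCompactSupport.of_compactSpace f)

theorem lintegral_diskKernel {w : ℂ} (hw : ‖w‖ < 1) :
    ∫⁻ ω, ENNReal.ofReal (diskKernel w ω) ∂freqMeasure = 1 := by
  rw [← ofReal_integral_eq_lintegral_ofReal (integrable_of_continuous (continuous_diskKernel hw))
    (Eventually.of_forall (diskKernel_nonneg hw)), integral_diskKernel hw, ENNReal.ofReal_one]

theorem integrable_diskKernel_smul {E : Type*} [NormedAddCommGroup E] [NormedSpace ℝ E] {w : ℂ}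
    (hw : ‖w‖ < 1) {f : Freq → E} (hf : Integrable f freqMeasure) :
    Integrable (fun ω => diskKernel w ω • f ω) freqMeasure := by
  obtain ⟨C, hC⟩ := (isCompact_univ.bddAbove_image
    (continuous_diskKernel hw).norm.continuousOn)
  refine hf.bdd_smul C (continuous_diskKernel hw).aestronglyMeasurable ?_
  exact Eventually.of_forall fun ω => hC ⟨ω, Set.mem_univ _, rfl⟩

/-- The Poisson integral of `f` at the point `w` of the unit disc. -/
noncomputable def poissonInt (f : Freq → ℂ) (w : ℂ) : ℂ :=
  ∫ ω, diskKernel w ω • f ω ∂freqMeasure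

theorem poissonInt_fourier {r : ℝ} (hr : 0 ≤ r) (hr1 : r < 1) (n : ℤ) (θ : Freq) :
    poissonInt (fourier n) (r * (AddCircle.toCircle θ : ℂ)) =
      (r ^ n.natAbs : ℝ) * (fourier n θ : ℂ) := by
  have hw : ‖(r : ℂ) * (AddCircle.toCircle θ : ℂ)‖ < 1 := by rwa [norm_mul_toCircle hr]
  obtain ⟨m, rfl | rfl⟩ := n.eq_nat_or_neg
  · rw [poissonInt, integral_diskKernel_fourier_nat hw, fourier_natCast, mul_pow]
    simp
  · rw [poissonInt, integral_diskKernel_fourier_neg hw, fourier_neg, fourier_natCast, map_mul,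
      mul_pow, map_pow, Complex.conj_ofReal]
    simp

section L1

variable {f g : Freq → ℂ} {r : ℝ}

theorem aestronglyMeasurable_diskKernel_smul (hr : 0 ≤ r) (hr1 : r < 1)
    (hf : AEStronglyMeasurable f freqMeasure) :
    AEStronglyMeasurable (fun x : Freq × Freq => diskKernel (r * (AddCircle.toCircle x.1 : ℂ)) x.2 •
      f x.2) (freqMeasure.prod freqMeasure) :=
  (continuous_diskKernel_prod hr hr1).aestronglyMeasurable.smul hf.comp_snd

theorem aestronglyMeasurable_poissonInt (hr : 0 ≤ r) (hr1 : r < 1)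
    (hf : AEStronglyMeasurable f freqMeasure) :
    AEStronglyMeasurable (fun θ => poissonInt f (r * (AddCircle.toCircle θ : ℂ))) freqMeasure :=
  (aestronglyMeasurable_diskKernel_smul hr hr1 hf).integral_prod_right'

/-- Averaging a nonnegative function over the circle after Poisson smoothing changes nothing,
because the kernel is symmetric. -/
theorem lintegral_lintegral_diskKernel (hr : 0 ≤ r) (hr1 : r < 1) {h : Freq → ℝ≥0∞}
    (hh : AEMeasurable h freqMeasure) :
    ∫⁻ θ, ∫⁻ ω, ENNReal.ofReal (diskKernel (r * (AddCircle.toCircle θ : ℂ)) ω) * h ω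
      ∂freqMeasure ∂freqMeasure = ∫⁻ ω, h ω ∂freqMeasure := by
  rw [lintegral_lintegral_swap]
  · refine lintegral_congr fun ω => ?_
    rw [lintegral_mul_const'' _ ?_]
    · simp_rw [diskKernel_symm hr _ ω]
      rw [lintegral_diskKernel, one_mul]
      rwa [norm_mul_toCircle hr]
    · exact (ENNReal.continuous_ofReal.comp ((continuous_diskKernel_prod hr hr1).comp
        (Continuous.prodMk continuous_id continuous_const))).aemeasurable
  · exact ((ENNReal.continuous_ofReal.comp
      (continuous_diskKernel_prod hr hr1)).aemeasurable).mul hh.comp_snd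

theorem lintegral_enorm_poissonInt_le (hr : 0 ≤ r) (hr1 : r < 1)
    (hf : AEStronglyMeasurable f freqMeasure) :
    ∫⁻ θ, ‖poissonInt f (r * (AddCircle.toCircle θ : ℂ))‖ₑ ∂freqMeasure ≤
      ∫⁻ ω, ‖f ω‖ₑ ∂freqMeasure := by
  rw [← lintegral_lintegral_diskKernel hr hr1 hf.enorm]
  refine lintegral_mono fun θ => (enorm_integral_le_lintegral_enorm _).trans_eq ?_
  refine lintegral_congr fun ω => ?_
  rw [enorm_smul, Real.enorm_of_nonneg (diskKernel_nonneg (by rwa [norm_mul_toCircle hr]) ω)]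

/-- The `L¹` distance between `f` and its Poisson integral on the circle of radius `r`. -/
noncomputable def poissonDist (f : Freq → ℂ) (r : ℝ) : ℝ≥0∞ :=
  ∫⁻ θ, ‖poissonInt f (r * (AddCircle.toCircle θ : ℂ)) - f θ‖ₑ ∂freqMeasure

theorem poissonDist_congr (h : f =ᵐ[freqMeasure] g) : poissonDist f r = poissonDist g r := by
  have h1 (w : ℂ) : poissonInt f w = poissonInt g w :=
    integral_congr_ae (h.mono fun ω hω => by simp only [hω])
  refine lintegral_congr_ae (h.mono fun θ hθ => ?_)
  simp only [h1, hθ]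

theorem poissonDist_add_le (hr : 0 ≤ r) (hr1 : r < 1) (hf : Integrable f freqMeasure)
    (hg : Integrable g freqMeasure) :
    poissonDist (f + g) r ≤ poissonDist f r + poissonDist g r := by
  unfold poissonDist
  rw [← lintegral_add_left']
  · refine lintegral_mono fun θ => ?_
    have hw : ‖(r : ℂ) * (AddCircle.toCircle θ : ℂ)‖ < 1 := by rwa [norm_mul_toCircle hr]
    have : poissonInt (f + g) (r * (AddCircle.toCircle θ : ℂ)) =
        poissonInt f (r * (AddCircle.toCircle θ : ℂ)) +
          poissonInt g (r * (AddCircle.toCircle θ : ℂ)) := by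
      simp only [poissonInt, Pi.add_apply, smul_add]
      exact integral_add (integrable_diskKernel_smul hw hf) (integrable_diskKernel_smul hw hg)
    simp only [this, Pi.add_apply, add_sub_add_comm]
    exact enorm_add_le _ _
  · exact ((aestronglyMeasurable_poissonInt hr hr1 hf.1).sub hf.1).enorm

theorem poissonDist_const_smul (c : ℂ) : poissonDist (c • f) r = ‖c‖ₑ * poissonDist f r := by
  unfold poissonDist
  rw [← lintegral_const_mul' _ _ enorm_ne_top]
  refine lintegral_congr fun θ => ?_
  have : poissonInt (c • f) (r * (AddCircle.toCircle θ : ℂ)) =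
      c • poissonInt f (r * (AddCircle.toCircle θ : ℂ)) := by
    simp only [poissonInt, Pi.smul_apply, smul_comm _ c]
    exact integral_smul _ _
  rw [this, Pi.smul_apply, ← smul_sub, enorm_smul]

theorem poissonDist_le (hr : 0 ≤ r) (hr1 : r < 1) (hf : Integrable f freqMeasure) :
    poissonDist f r ≤ 2 * ∫⁻ ω, ‖f ω‖ₑ ∂freqMeasure := by
  calc poissonDist f r
      ≤ ∫⁻ θ, (‖poissonInt f (r * (AddCircle.toCircle θ : ℂ))‖ₑ + ‖f θ‖ₑ) ∂freqMeasure :=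
        lintegral_mono fun θ => enorm_sub_le
    _ = ∫⁻ θ, ‖poissonInt f (r * (AddCircle.toCircle θ : ℂ))‖ₑ ∂freqMeasure +
          ∫⁻ ω, ‖f ω‖ₑ ∂freqMeasure := lintegral_add_right' _ hf.1.enorm
    _ ≤ _ := by
        rw [two_mul (lintegral _ _)]
        exact add_le_add (lintegral_enorm_poissonInt_le hr hr1 hf.1) le_rfl

theorem eventually_mem_Ico : ∀ᶠ r : ℝ in 𝓝[<] 1, 0 ≤ r ∧ r < 1 := by
  filter_upwards [self_mem_nhdsWithin, mem_nhdsWithin_of_mem_nhds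
    (Ioi_mem_nhds (show (0 : ℝ) < 1 by norm_num))] with r h1 h2
  exact ⟨h2.le, h1⟩

theorem tendsto_poissonDist_fourier (n : ℤ) :
    Tendsto (poissonDist (fourier n)) (𝓝[<] 1) (𝓝 0) := by
  have h1 : Tendsto (fun r : ℝ => ENNReal.ofReal (1 - r ^ n.natAbs)) (𝓝[<] 1) (𝓝 0) := by
    have : Tendsto (fun r : ℝ => ENNReal.ofReal (1 - r ^ n.natAbs)) (𝓝 1)
        (𝓝 (ENNReal.ofReal (1 - 1 ^ n.natAbs))) :=
      (ENNReal.continuous_ofReal.comp (by fun_prop)).tendsto _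
    simp only [one_pow, sub_self, ENNReal.ofReal_zero] at this
    exact this.mono_left nhdsWithin_le_nhds
  refine h1.congr' ?_
  filter_upwards [eventually_mem_Ico] with r ⟨hr, hr1⟩
  have h2 (θ : Freq) : ‖poissonInt (fourier n) (r * (AddCircle.toCircle θ : ℂ)) - fourier n θ‖ₑ =
      ENNReal.ofReal (1 - r ^ n.natAbs) := by
    rw [poissonInt_fourier hr hr1, ← sub_one_mul, enorm_mul, ← ofReal_norm (fourier n θ),
      fourier_apply, Circle.norm_coe, ENNReal.ofReal_one, mul_one, ← ofReal_norm,
      ← Complex.ofReal_one, ← Complex.ofReal_sub, Complex.norm_real, norm_sub_rev,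
      Real.norm_of_nonneg]
    exact sub_nonneg.2 (pow_le_one₀ hr hr1.le)
  rw [poissonDist, lintegral_congr h2, lintegral_const, measure_univ, mul_one]

/-- The functions that are the `L¹` limits of their Poisson integrals. -/
noncomputable def poissonLimits : Submodule ℂ (Lp ℂ 1 freqMeasure) where
  carrier := {f | Tendsto (poissonDist f) (𝓝[<] 1) (𝓝 0)}
  zero_mem' := by
    refine tendsto_const_nhds.congr fun r => ?_
    rw [poissonDist_congr (Lp.coeFn_zero ℂ 1 freqMeasure)]
    simp [poissonDist, poissonInt]
  add_mem' := by
    intro f g hf hg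
    refine tendsto_of_tendsto_of_tendsto_of_le_of_le' tendsto_const_nhds
      (by simpa using Tendsto.add hf hg) (Eventually.of_forall fun _ => zero_le) ?_
    filter_upwards [eventually_mem_Ico] with r ⟨hr, hr1⟩
    rw [poissonDist_congr (Lp.coeFn_add f g)]
    exact poissonDist_add_le hr hr1 (L1.integrable_coeFn f) (L1.integrable_coeFn g)
  smul_mem' := by
    intro c f hf
    have h := ENNReal.Tendsto.const_mul (a := ‖c‖ₑ) hf (Or.inr enorm_ne_top)
    rw [mul_zero] at h
    refine h.congr fun r => ?_
    rw [poissonDist_congr (Lp.coeFn_smul c f), poissonDist_const_smul]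

/-- Poisson integrals are `L¹` contractions for every radius, so convergence on a dense set of
functions carries over to its closure. -/
theorem isClosed_poissonLimits :
    IsClosed (poissonLimits : Set (Lp ℂ 1 freqMeasure)) := by
  refine isClosed_of_closure_subset fun f hf => ?_
  change Tendsto (poissonDist f) (𝓝[<] 1) (𝓝 0)
  refine ENNReal.tendsto_nhds_zero.2 fun e he => ?_
  obtain ⟨e', he', he'2⟩ : ∃ e' : ℝ≥0∞, 0 < e' ∧ 2 * e' + e' ≤ e := by
    refine ⟨e / 3, ENNReal.div_pos he.ne' (by norm_num), le_of_eq ?_⟩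
    rw [← add_one_mul, show (2 : ℝ≥0∞) + 1 = 3 by norm_num]
    exact ENNReal.mul_div_cancel (by norm_num) (by norm_num)
  obtain ⟨g, hg, hfg⟩ := EMetric.mem_closure_iff.1 hf e' he'
  have hg' : Tendsto (poissonDist g) (𝓝[<] 1) (𝓝 0) := hg
  filter_upwards [eventually_mem_Ico, ENNReal.tendsto_nhds_zero.1 hg' e' he'] with r ⟨hr, hr1⟩ hgr
  have hsub : (f : Freq → ℂ) =ᵐ[freqMeasure] (⇑(f - g) + ⇑g) := by
    filter_upwards [Lp.coeFn_sub f g] with ω hω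
    rw [Pi.add_apply, hω, Pi.sub_apply, sub_add_cancel]
  rw [poissonDist_congr hsub]
  refine (poissonDist_add_le hr hr1 (L1.integrable_coeFn _) (L1.integrable_coeFn g)).trans ?_
  refine le_trans (add_le_add ((poissonDist_le hr hr1 (L1.integrable_coeFn _)).trans ?_) hgr) he'2
  gcongr
  rw [edist_eq_enorm_sub, Lp.enorm_def, eLpNorm_one_eq_lintegral_enorm] at hfg
  exact hfg.le

/-- An integrable function is the `L¹` limit of its Poisson integrals. -/
theorem tendsto_poissonDist (hf : Integrable f freqMeasure) :
    Tendsto (poissonDist f) (𝓝[<] 1) (𝓝 0) := by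
  have htop : poissonLimits = ⊤ := by
    rw [eq_top_iff, ← span_fourierLp_closure_eq_top (T := 2 * π) (p := 1) (by norm_num)]
    refine Submodule.topologicalClosure_minimal _ (Submodule.span_le.2 ?_) isClosed_poissonLimits
    rintro _ ⟨n, rfl⟩
    change Tendsto _ _ _
    exact (tendsto_poissonDist_fourier n).congr fun r =>
      (poissonDist_congr (coeFn_fourierLp 1 n)).symm
  have hmem : hf.toL1 f ∈ poissonLimits := htop ▸ Submodule.mem_top
  exact Tendsto.congr (fun r => poissonDist_congr hf.coeFn_toL1) hmem

/-- An integrable function whose Fourier coefficients vanish is zero almost everywhere. -/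
theorem ae_eq_zero_of_fourierCoeff (hf : Integrable f freqMeasure)
    (h : ∀ n, fourierCoeff f n = 0) : f =ᵐ[freqMeasure] 0 := by
  have hint (c : C(Freq, ℂ)) : Integrable (fun ω => c ω * f ω) freqMeasure :=
    hf.bdd_mul c.continuous.aestronglyMeasurable
      (Eventually.of_forall fun ω => c.norm_coe_le_norm ω)
  -- integration against `f` annihilates trigonometric polynomials, hence all continuous functions,
  -- and among them the Poisson kernels
  let Φ : C(Freq, ℂ) →L[ℂ] ℂ := LinearMap.mkContinuous
    { toFun := fun c => ∫ ω, c ω * f ω ∂freqMeasure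
      map_add' := fun c d => by
        simp only [ContinuousMap.add_apply, add_mul]
        exact integral_add (hint c) (hint d)
      map_smul' := fun a c => by
        simp only [ContinuousMap.smul_apply, smul_mul_assoc, RingHom.id_apply]
        exact integral_smul _ _ } (∫ ω, ‖f ω‖ ∂freqMeasure) fun c => by
      refine (norm_integral_le_integral_norm _).trans ?_
      rw [mul_comm (integral _ _), ← integral_const_mul]
      refine integral_mono (hint c).norm (hf.norm.const_mul _) fun ω => ?_
      simp only [norm_mul]
      gcongr
      exact c.norm_coe_le_norm ω
  have hker : LinearMap.ker Φ.toLinearMap = ⊤ := by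
    rw [eq_top_iff, ← span_fourier_closure_eq_top (T := 2 * π)]
    refine Submodule.topologicalClosure_minimal _ (Submodule.span_le.2 ?_) Φ.isClosed_ker
    rintro _ ⟨n, rfl⟩
    have := h (-n)
    rw [fourierCoeff, neg_neg] at this
    exact this
  have hzero {w : ℂ} (hw : ‖w‖ < 1) : poissonInt f w = 0 := by
    have : (⟨fun ω => (diskKernel w ω : ℂ),
        Complex.continuous_ofReal.comp (continuous_diskKernel hw)⟩ : C(Freq, ℂ)) ∈
          LinearMap.ker Φ.toLinearMap := hker ▸ Submodule.mem_top
    exact this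
  have hlim : Tendsto (poissonDist f) (𝓝[<] 1) (𝓝 (∫⁻ ω, ‖f ω‖ₑ ∂freqMeasure)) := by
    refine tendsto_const_nhds.congr' ?_
    filter_upwards [eventually_mem_Ico] with r ⟨hr, hr1⟩
    refine lintegral_congr fun θ => ?_
    rw [hzero (by rwa [norm_mul_toCircle hr]), zero_sub, enorm_neg]
  have h0 := tendsto_nhds_unique hlim (tendsto_poissonDist hf)
  rw [lintegral_eq_zero_iff' hf.1.enorm] at h0
  filter_upwards [h0] with ω hω
  simpa using hω

theorem ae_eq_of_fourierCoeff (hf : Integrable f freqMeasure) (hg : Integrable g freqMeasure)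
    (h : ∀ n, fourierCoeff f n = fourierCoeff g n) : f =ᵐ[freqMeasure] g := by
  have := ae_eq_zero_of_fourierCoeff (hf.sub hg) fun n => by
    have h1 : fourierCoeff (f - g) n = fourierCoeff f n - fourierCoeff g n := by
      simp only [fourierCoeff, Pi.sub_apply, smul_sub]
      exact integral_sub (hf.fourier_smul _) (hg.fourier_smul _)
    rw [h1, h, sub_self]
  filter_upwards [this] with ω hω
  exact sub_eq_zero.1 hω

end L1

/-! ### Products and symmetry of frequency responses -/

/-- Multiplication by the frequency response of `g` acts on Fourier coefficients as the convolution
with `g`: the coefficients of the product are inner products, which may be summed term by term. -/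
theorem fourierCoeff_mul_freqResponse {f : Freq → ℂ} (hf : MemLp f 2 freqMeasure) {g : ℕ → ℝ}
    (hg : Summable fun t => g t ^ 2) (n : ℤ) :
    HasSum (fun t : ℕ => (g t : ℂ) * fourierCoeff f (n + t))
      (fourierCoeff (fun ω => f ω * freqResponse g ω) n) := by
  have hφ : MemLp (fun ω => (starRingEnd ℂ) (fourier (-n) ω * f ω)) 2 freqMeasure := by
    refine MemLp.star (f := fun ω => (fourier (-n) ω * f ω : ℂ)) ?_
    refine hf.of_le_mul (c := 1) ?_ (Eventually.of_forall fun ω => ?_)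
    · exact (fourier (-n)).continuous.aestronglyMeasurable.mul hf.1
    · rw [norm_mul, fourier_apply, Circle.norm_coe]
  have hinner (G : Lp ℂ 2 freqMeasure) : inner ℂ (hφ.toLp _) G =
      ∫ ω, fourier (-n) ω * f ω * G ω ∂freqMeasure := by
    rw [L2.inner_def]
    refine integral_congr_ae ?_
    filter_upwards [hφ.coeFn_toLp] with ω hω
    rw [hω, RCLike.inner_apply, RCLike.conj_conj, mul_comm]
  have h := (hasSum_freqResponse hg).mapL (innerSL ℂ (hφ.toLp _))
  simp only [innerSL_apply_apply, inner_smul_right] at h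
  simp only [hinner] at h
  have h1 : fourierCoeff (fun ω => f ω * freqResponse g ω) n =
      ∫ ω, fourier (-n) ω * f ω * freqResponse g ω ∂freqMeasure := by
    simp only [fourierCoeff, smul_eq_mul, mul_assoc]
  rw [h1]
  refine h.congr_fun fun t => ?_
  congr 1
  rw [fourierCoeff]
  refine integral_congr_ae ?_
  filter_upwards [coeFn_fourierLp (T := 2 * π) 2 (-(t : ℤ))] with ω hω
  rw [hω, neg_add, fourier_add, smul_eq_mul]
  ring

theorem fourierCoeff_freqResponse_mul {g h : ℕ → ℝ} (hg : Summable fun t => g t ^ 2)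
    (hh : Summable fun t => h t ^ 2) (n : ℤ) :
    fourierCoeff (fun ω => freqResponse g ω * freqResponse h ω) n =
      if n ≤ 0 then (conv g h n.natAbs : ℂ) else 0 := by
  refine (fourierCoeff_mul_freqResponse (Lp.memLp _) hh n).unique ?_
  simp only [fourierCoeff_freqResponse hg]
  split_ifs with hn
  · have h2 : (conv g h n.natAbs : ℂ) = ∑ t ∈ Finset.range (n.natAbs + 1),
        (h t : ℂ) * (if n + t ≤ 0 then (g (n + t).natAbs : ℂ) else 0) := by
      rw [conv_comm, conv, Finset.Nat.sum_antidiagonal_eq_sum_range_succ_mk]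
      push_cast
      refine Finset.sum_congr rfl fun t ht => ?_
      have := Finset.mem_range.1 ht
      rw [if_pos (by omega), show (n + t).natAbs = n.natAbs - t by omega]
    rw [h2]
    refine hasSum_sum_of_ne_finset_zero fun t ht => ?_
    rw [Finset.mem_range] at ht
    rw [if_neg (by omega), mul_zero]
  · have h2 : (fun t : ℕ => (h t : ℂ) * if n + t ≤ 0 then (g (n + t).natAbs : ℂ) else 0) =
        fun _ => 0 := funext fun t => by rw [if_neg (by omega), mul_zero]
    rw [h2]
    exact hasSum_zero

theorem integrable_freqResponse_mul (g h : ℕ → ℝ) :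
    Integrable (fun ω => freqResponse g ω * freqResponse h ω) freqMeasure :=
  MemLp.integrable_mul (Lp.memLp _) (Lp.memLp _)

/-- The frequency response of a series connection is the product of the frequency responses. -/
theorem freqResponse_conv {g h : ℕ → ℝ} (hg : Summable fun t => g t ^ 2)
    (hh : Summable fun t => h t ^ 2) (hgh : Summable fun t => conv g h t ^ 2) :
    freqResponse (conv g h) =ᵐ[freqMeasure] fun ω => freqResponse g ω * freqResponse h ω := by
  refine ae_eq_of_fourierCoeff ((Lp.memLp _).integrable (by norm_num))
    (integrable_freqResponse_mul g h) fun n => ?_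
  rw [fourierCoeff_freqResponse hgh, fourierCoeff_freqResponse_mul hg hh]

/-- The energy of a convolution is at most the integral of the squared product of the frequency
responses, which need not be finite. -/
theorem tsum_conv_sq_le {g h : ℕ → ℝ} (hg : Summable fun t => g t ^ 2)
    (hh : Summable fun t => h t ^ 2) :
    ∑' t, ENNReal.ofReal (conv g h t ^ 2) ≤
      ∫⁻ ω, ‖freqResponse g ω‖ₑ ^ 2 * ‖freqResponse h ω‖ₑ ^ 2 ∂freqMeasure := by
  have h1 : ∫⁻ ω, ‖freqResponse g ω‖ₑ ^ 2 * ‖freqResponse h ω‖ₑ ^ 2 ∂freqMeasure =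
      ∫⁻ ω, ‖freqResponse g ω * freqResponse h ω‖ₑ ^ 2 ∂freqMeasure := by
    refine lintegral_congr fun ω => ?_
    rw [enorm_mul, mul_pow]
  rw [h1]
  by_cases htop : ∫⁻ ω, ‖freqResponse g ω * freqResponse h ω‖ₑ ^ 2 ∂freqMeasure = ∞
  · rw [htop]; exact le_top
  have hmem : MemLp (fun ω => freqResponse g ω * freqResponse h ω) 2 freqMeasure := by
    refine ⟨(integrable_freqResponse_mul g h).1, ?_⟩
    rw [eLpNorm_lt_top_iff_lintegral_rpow_enorm_lt_top (by norm_num) (by norm_num)]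
    simpa using lt_top_iff_ne_top.2 htop
  refine le_trans (le_of_eq (tsum_congr fun t => ?_)) (tsum_enorm_fourierCoeff_neg_le hmem)
  rw [fourierCoeff_freqResponse_mul hg hh, if_pos (by simp), ← enorm_ofReal_sq]
  simp

theorem fourierCoeff_conj_neg (f : Freq → ℂ) (n : ℤ) :
    fourierCoeff (fun ω => (starRingEnd ℂ) (f (-ω))) n = (starRingEnd ℂ) (fourierCoeff f n) := by
  rw [fourierCoeff, fourierCoeff, ← integral_conj, ← integral_neg_eq_self]
  refine integral_congr_ae (Eventually.of_forall fun ω => ?_)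
  simp only [neg_neg, smul_eq_mul, map_mul]
  congr 1
  rw [← fourier_neg, neg_neg, fourier_apply, fourier_apply]
  simp

/-- Real impulse responses have conjugate-symmetric frequency responses. -/
theorem freqResponse_neg {g : ℕ → ℝ} (hg : Summable fun t => g t ^ 2) :
    ∀ᵐ ω ∂freqMeasure, freqResponse g (-ω) = (starRingEnd ℂ) (freqResponse g ω) := by
  have hint : Integrable (freqResponse g) freqMeasure := (Lp.memLp _).integrable (by norm_num)
  have hneg : Integrable (fun ω => (starRingEnd ℂ) (freqResponse g (-ω))) freqMeasure :=
    Complex.conjCLE.toContinuousLinearMap.integrable_comp hint.comp_neg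
  have h := ae_eq_of_fourierCoeff hneg hint fun n => by
    rw [fourierCoeff_conj_neg, fourierCoeff_freqResponse hg]
    split_ifs <;> simp
  filter_upwards [h] with ω hω
  rw [← hω, Complex.conj_conj]

theorem fourierCoeff_of_even {u : Freq → ℝ} (hu : ∀ᵐ ω ∂freqMeasure, u (-ω) = u ω) (n : ℤ) :
    ((fourierCoeff (fun ω => (u ω : ℂ)) n).re : ℂ) = fourierCoeff (fun ω => (u ω : ℂ)) n := by
  refine Complex.conj_eq_iff_re.1 ?_
  rw [← fourierCoeff_conj_neg]
  refine congrFun (fourierCoeff_congr_ae ?_) n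
  filter_upwards [hu] with ω hω
  simp [hω]

variable {m p : ℕ} {F : LTI m p}

theorem LTI.colNorm_nonneg (F : LTI m p) (i : Fin m) (ω : Freq) : 0 ≤ F.colNorm i ω :=
  Real.sqrt_nonneg _

theorem LTI.colNorm_sq (F : LTI m p) (i : Fin m) (ω : Freq) :
    F.colNorm i ω ^ 2 = ∑ j, ‖freqResponse (fun t => F t j i) ω‖ ^ 2 :=
  Real.sq_sqrt (Finset.sum_nonneg fun _ _ => sq_nonneg _)

theorem LTI.ofReal_colNorm_sq (F : LTI m p) (i : Fin m) (ω : Freq) :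
    ENNReal.ofReal (F.colNorm i ω ^ 2) = ∑ j, ‖freqResponse (fun t => F t j i) ω‖ₑ ^ 2 := by
  rw [LTI.colNorm_sq, ENNReal.ofReal_sum_of_nonneg fun _ _ => sq_nonneg _]
  simp only [ENNReal.ofReal_pow (norm_nonneg _), ofReal_norm]

theorem LTI.aestronglyMeasurable_colNorm (F : LTI m p) (i : Fin m) :
    AEStronglyMeasurable (F.colNorm i) freqMeasure := by
  refine Real.continuous_sqrt.comp_aestronglyMeasurable ?_
  refine Finset.aestronglyMeasurable_fun_sum _ fun j _ => ?_
  exact (Lp.aestronglyMeasurable _).norm.pow 2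

theorem LTI.memLp_colNorm (F : LTI m p) (i : Fin m) : MemLp (F.colNorm i) 2 freqMeasure := by
  rw [memLp_two_iff_integrable_sq (F.aestronglyMeasurable_colNorm i)]
  simp only [LTI.colNorm_sq]
  exact integrable_finsetSum _ fun j _ => (Lp.memLp _).integrable_norm_pow (by norm_num)

theorem LTI.integrable_colNorm (F : LTI m p) (i : Fin m) :
    Integrable (F.colNorm i) freqMeasure :=
  (F.memLp_colNorm i).integrable (by norm_num)

theorem LTI.colNorm_neg (hF : F.h2NormSq < ∞) (i : Fin m) :
    ∀ᵐ ω ∂freqMeasure, F.colNorm i (-ω) = F.colNorm i ω := by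
  have h := ae_all_iff.2 fun j => freqResponse_neg (LTI.summable_of_h2NormSq_lt_top hF j i)
  filter_upwards [h] with ω hω
  simp [LTI.colNorm, hω]

/-- `‖F‖₂²` is the integral of the squared column norms of the frequency response. -/
theorem LTI.lintegral_colNorm_sq (hF : F.h2NormSq < ∞) :
    ∑ i, ∫⁻ ω, ENNReal.ofReal (F.colNorm i ω ^ 2) ∂freqMeasure = F.h2NormSq := by
  rw [LTI.h2NormSq_eq]
  refine Finset.sum_congr rfl fun i _ => ?_
  simp only [LTI.ofReal_colNorm_sq]
  rw [lintegral_finsetSum']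
  · exact Finset.sum_congr rfl fun j _ =>
      lintegral_freqResponse_sq (LTI.summable_of_h2NormSq_lt_top hF j i)
  · intro j _
    exact (Lp.aestronglyMeasurable _).enorm.pow_const _

/-! ### Exponentials of power series -/

/-- The coefficients of the power series `exp (∑ n, a n * X ^ n)`, by the recursion that expresses
that its derivative is its product with the derivative of `∑ n, a n * X ^ n`. -/
noncomputable def expCoeff (a : ℕ → ℝ) : ℕ → ℝ
  | 0 => Real.exp (a 0)
  | n + 1 => (∑ k : Fin (n + 1), (k + 1) * a (k + 1) * expCoeff a (n - k)) / (n + 1)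
  decreasing_by omega

theorem expCoeff_zero (a : ℕ → ℝ) : expCoeff a 0 = Real.exp (a 0) := by rw [expCoeff]

theorem expCoeff_succ (a : ℕ → ℝ) (n : ℕ) :
    expCoeff a (n + 1) * (n + 1) =
      ∑ k ∈ Finset.range (n + 1), (k + 1) * a (k + 1) * expCoeff a (n - k) := by
  rw [expCoeff, div_mul_cancel₀ _ (by positivity),
    Fin.sum_univ_eq_sum_range fun k => (k + 1) * a (k + 1) * expCoeff a (n - k)]

theorem tendsto_expCoeff {ι : Type*} {l : Filter ι} {a : ι → ℕ → ℝ} {b : ℕ → ℝ}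
    (h : ∀ n, Tendsto (fun N => a N n) l (𝓝 (b n))) (n : ℕ) :
    Tendsto (fun N => expCoeff (a N) n) l (𝓝 (expCoeff b n)) := by
  induction n using Nat.strong_induction_on with
  | _ n ih =>
    cases n with
    | zero =>
      simp only [expCoeff_zero]
      exact (Real.continuous_exp.tendsto _).comp (h 0)
    | succ n =>
      simp only [expCoeff]
      refine Tendsto.div_const (tendsto_finsetSum _ fun k _ => ?_) _
      exact ((h _).const_mul _).mul (ih _ (by omega))

/-- The formal identity `exp (-a) * exp a = 1`. -/
theorem conv_expCoeff_neg (a : ℕ → ℝ) (t : ℕ) :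
    conv (expCoeff fun n => -a n) (expCoeff a) t = if t = 0 then 1 else 0 := by
  have hd (b : ℕ → ℝ) : PowerSeries.derivative ℝ (PowerSeries.mk (expCoeff b)) =
      PowerSeries.derivative ℝ (PowerSeries.mk b) * PowerSeries.mk (expCoeff b) := by
    ext n
    rw [PowerSeries.coeff_derivative, PowerSeries.coeff_mk, expCoeff_succ, PowerSeries.coeff_mul,
      Finset.Nat.sum_antidiagonal_eq_sum_range_succ_mk]
    refine Finset.sum_congr rfl fun k _ => ?_
    simp only [PowerSeries.coeff_derivative, PowerSeries.coeff_mk]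
    ring
  have hneg : PowerSeries.mk (fun n => -a n) = -PowerSeries.mk a := by ext; simp
  have hmul : PowerSeries.mk (expCoeff fun n => -a n) * PowerSeries.mk (expCoeff a) = 1 := by
    refine PowerSeries.derivative.ext ?_ ?_
    · rw [Derivation.leibniz, hd, hd, hneg]
      simp only [smul_eq_mul, map_neg, Derivation.map_one_eq_zero]
      ring
    · simp [expCoeff_zero, ← Real.exp_add]
  have h := congrArg (PowerSeries.coeff t) hmul
  rw [PowerSeries.coeff_mul, PowerSeries.coeff_one] at h
  simpa [conv] using h

open Nat in
/-- Inside the unit disc `expCoeff a` sums to the exponential of the sum of `a`: the Taylor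
coefficients of that exponential satisfy the recursion which defines `expCoeff a`. -/
theorem hasSum_expCoeff {a : ℕ → ℝ} {M : ℝ} (ha : ∀ n, |a n| ≤ M) {w : ℂ} (hw : ‖w‖ < 1) :
    HasSum (fun n => (expCoeff a n : ℂ) * w ^ n) (Complex.exp (∑' n, (a n : ℂ) * w ^ n)) := by
  let p := FormalMultilinearSeries.ofScalars ℂ fun n => (a n : ℂ)
  have hrad : 1 ≤ p.radius := by
    refine p.le_radius_of_bound (r := 1) M fun n => ?_
    rw [FormalMultilinearSeries.ofScalars_norm]
    simpa using ha n
  have hp : HasFPowerSeriesOnBall p.sum p 0 1 :=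
    (p.hasFPowerSeriesOnBall (zero_lt_one.trans_le hrad)).mono zero_lt_one hrad
  have hsum (z : ℂ) : p.sum z = ∑' n, (a n : ℂ) * z ^ n := by
    simp [FormalMultilinearSeries.sum, p, mul_comm]
  have hball : Metric.eball (0 : ℂ) 1 = Metric.ball 0 1 := by
    rw [← ENNReal.coe_one, Metric.eball_coe, NNReal.coe_one]
  have hderiv (n : ℕ) : iteratedDeriv n p.sum 0 = n ! * a n := by
    have := hp.factorial_smul 1 n
    rw [iteratedDeriv_eq_iteratedFDeriv, ← this, FormalMultilinearSeries.ofScalars_apply_eq]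
    simp
  have hφ : DifferentiableOn ℂ p.sum (Metric.ball 0 1) := by
    rw [← hball]
    exact hp.differentiableOn
  have hf : DifferentiableOn ℂ (fun z => Complex.exp (p.sum z)) (Metric.ball 0 1) := hφ.cexp
  have hnhds : Metric.ball (0 : ℂ) 1 ∈ 𝓝 0 := Metric.ball_mem_nhds _ zero_lt_one
  have hfa : AnalyticAt ℂ (fun z => Complex.exp (p.sum z)) 0 := hf.analyticAt hnhds
  have hφa : AnalyticAt ℂ p.sum 0 := hφ.analyticAt hnhds
  have hode : deriv (fun z => Complex.exp (p.sum z)) =ᶠ[𝓝 0]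
      deriv p.sum * fun z => Complex.exp (p.sum z) := by
    filter_upwards [hφa.eventually_analyticAt] with z hz
    rw [deriv_cexp hz.differentiableAt, Pi.mul_apply, mul_comm]
  have hcoeff (n : ℕ) :
      iteratedDeriv n (fun z => Complex.exp (p.sum z)) 0 = n ! * expCoeff a n := by
    induction n using Nat.strong_induction_on with
    | _ n ih =>
      cases n with
      | zero =>
        have := hderiv 0
        simp only [iteratedDeriv_zero, factorial_zero, cast_one, one_mul] at this
        simp [expCoeff_zero, this]
      | succ n =>
        rw [iteratedDeriv_succ', hode.iteratedDeriv_eq,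
          iteratedDeriv_mul hφa.deriv.contDiffAt hfa.contDiffAt]
        have h1 : (((n + 1)! : ℝ) * expCoeff a (n + 1)) =
            ∑ k ∈ Finset.range (n + 1), (n.choose k : ℝ) * ((k + 1)! * a (k + 1)) *
              ((n - k)! * expCoeff a (n - k)) := by
          have h2 : ((n + 1)! : ℝ) * expCoeff a (n + 1) =
              n ! * (expCoeff a (n + 1) * (n + 1)) := by
            rw [factorial_succ]
            push_cast
            ring
          rw [h2, expCoeff_succ, Finset.mul_sum]
          refine Finset.sum_congr rfl fun k hk => ?_
          have hkn : k ≤ n := by have := Finset.mem_range.1 hk; omega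
          rw [← choose_mul_factorial_mul_factorial hkn, factorial_succ]
          push_cast
          ring
        have h3 := congrArg (fun x : ℝ => (x : ℂ)) h1
        push_cast at h3 ⊢
        rw [h3]
        refine Finset.sum_congr rfl fun k hk => ?_
        rw [← iteratedDeriv_succ', hderiv, ih _ (by omega)]
  have h := Complex.hasSum_taylorSeries_on_ball hf (z := w) (by simpa using hw)
  rw [← hsum]
  refine h.congr_fun fun n => ?_
  rw [hcoeff, sub_zero, smul_eq_mul, smul_eq_mul]
  have : (n ! : ℂ) ≠ 0 := by exact_mod_cast n.factorial_ne_zero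
  field_simp

/-! ### Outer functions with prescribed modulus -/

/-- The Taylor coefficients of the Herglotz integral of `u`, the analytic function on the unit disc
whose real part is the Poisson integral of `u`. They are real for even `u`, in which case taking
the real part changes nothing. -/
noncomputable def herglotzCoeff (u : Freq → ℝ) (n : ℕ) : ℝ :=
  (if n = 0 then 1 else 2) * (fourierCoeff (fun ω => (u ω : ℂ)) n).re

theorem norm_fourierCoeff_le (f : Freq → ℂ) (n : ℤ) :
    ‖fourierCoeff f n‖ ≤ ∫ ω, ‖f ω‖ ∂freqMeasure := by
  refine (norm_integral_le_integral_norm _).trans_eq ?_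
  refine integral_congr_ae (Eventually.of_forall fun ω => ?_)
  simp only [norm_smul, fourier_apply, Circle.norm_coe, one_mul]

theorem abs_herglotzCoeff_sub_le {u v : Freq → ℝ} (hu : Integrable u freqMeasure)
    (hv : Integrable v freqMeasure) (n : ℕ) :
    |herglotzCoeff u n - herglotzCoeff v n| ≤ 2 * ∫ ω, |u ω - v ω| ∂freqMeasure := by
  have h1 : fourierCoeff (fun ω => (u ω : ℂ)) n - fourierCoeff (fun ω => (v ω : ℂ)) n =
      fourierCoeff (fun ω => ((u ω - v ω : ℝ) : ℂ)) n := by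
    simp only [fourierCoeff, Complex.ofReal_sub, smul_sub]
    exact (integral_sub (hu.ofReal.fourier_smul _) (hv.ofReal.fourier_smul _)).symm
  have h2 : |(fourierCoeff (fun ω => ((u ω - v ω : ℝ) : ℂ)) n).re| ≤
      ∫ ω, |u ω - v ω| ∂freqMeasure := by
    refine (Complex.abs_re_le_norm _).trans ((norm_fourierCoeff_le _ n).trans_eq ?_)
    simp only [Complex.norm_real, Real.norm_eq_abs]
  rw [herglotzCoeff, herglotzCoeff, ← mul_sub, ← Complex.sub_re, h1, abs_mul]
  refine mul_le_mul ?_ h2 (abs_nonneg _) (by norm_num)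
  split_ifs <;> norm_num

theorem abs_herglotzCoeff_le {u : Freq → ℝ} (hu : Integrable u freqMeasure) (n : ℕ) :
    |herglotzCoeff u n| ≤ 2 * ∫ ω, |u ω| ∂freqMeasure := by
  have h0 : herglotzCoeff 0 n = 0 := by simp [herglotzCoeff, fourierCoeff]
  simpa [h0] using abs_herglotzCoeff_sub_le hu (integrable_zero Freq ℝ freqMeasure) n

theorem herglotzCoeff_neg (u : Freq → ℝ) (n : ℕ) :
    herglotzCoeff (fun ω => -u ω) n = -herglotzCoeff u n := by
  have h : fourierCoeff (fun ω => ((-u ω : ℝ) : ℂ)) n = -fourierCoeff (fun ω => (u ω : ℂ)) n := by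
    simp only [fourierCoeff, Complex.ofReal_neg, smul_neg, integral_neg]
  rw [herglotzCoeff, herglotzCoeff, h, Complex.neg_re, mul_neg]

theorem hasSum_herglotz {w : ℂ} (hw : ‖w‖ < 1) (ω : Freq) :
    HasSum (fun n : ℕ => (if n = 0 then 1 else 2 : ℂ) * w ^ n * fourier (-(n : ℤ)) ω)
      (herglotzRieszKernel 0 w (AddCircle.toCircle ω : ℂ)) := by
  set e : ℂ := (AddCircle.toCircle ω : ℂ) with he
  have he0 : e ≠ 0 := by
    rw [← norm_pos_iff, he, norm_toCircle]; exact one_pos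
  have hf (n : ℕ) : (fourier (-(n : ℤ)) ω : ℂ) = (e⁻¹) ^ n := by
    rw [fourier_neg, fourier_natCast, map_pow, ← he, Complex.inv_def, Complex.normSq_eq_norm_sq, he,
      norm_toCircle]
    simp
  have hq : ‖w * e⁻¹‖ < 1 := by
    rw [norm_mul, norm_inv, he, norm_toCircle]
    simpa using hw
  have h1 := (hasSum_geometric_of_norm_lt_one hq).mul_left 2
  have h2 := h1.sub (hasSum_ite_eq 0 (1 : ℂ))
  have hne := toCircle_sub_ne_zero hw ω
  rw [← he] at hne
  have hval : 2 * (1 - w * e⁻¹)⁻¹ - 1 = herglotzRieszKernel 0 w e := by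
    have h3 : 1 - w * e⁻¹ = (e - w) / e := by field_simp
    rw [h3, herglotzRieszKernel_def, inv_div]
    simp only [sub_zero]
    field_simp
    ring
  rw [hval] at h2
  refine h2.congr_fun fun n => ?_
  rw [hf, mul_assoc, ← mul_pow]
  by_cases hn : n = 0
  · subst hn
    norm_num
  · simp [hn]

/-- The Herglotz series sums to an analytic function whose real part is the Poisson integral. -/
theorem re_tsum_herglotzCoeff {u : Freq → ℝ} (hu : Integrable u freqMeasure)
    (heven : ∀ᵐ ω ∂freqMeasure, u (-ω) = u ω) {w : ℂ} (hw : ‖w‖ < 1) :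
    (∑' n, (herglotzCoeff u n : ℂ) * w ^ n).re = ∫ ω, diskKernel w ω * u ω ∂freqMeasure := by
  have hI (n : ℕ) : Integrable (fun ω => (if n = 0 then 1 else 2 : ℂ) * w ^ n *
      fourier (-(n : ℤ)) ω * (u ω : ℂ)) freqMeasure := by
    have := (hu.ofReal (𝕜 := ℂ)).fourier_smul (-(n : ℤ))
    refine (this.const_mul ((if n = 0 then 1 else 2 : ℂ) * w ^ n)).congr
      (Eventually.of_forall fun ω => ?_)
    simp only [smul_eq_mul, mul_assoc]
    rfl
  have hS : Summable fun n : ℕ => ∫ ω, ‖(if n = 0 then 1 else 2 : ℂ) * w ^ n *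
      fourier (-(n : ℤ)) ω * (u ω : ℂ)‖ ∂freqMeasure := by
    have hle (n : ℕ) : ∫ ω, ‖(if n = 0 then 1 else 2 : ℂ) * w ^ n *
        fourier (-(n : ℤ)) ω * (u ω : ℂ)‖ ∂freqMeasure ≤
          ‖w‖ ^ n * (2 * ∫ ω, |u ω| ∂freqMeasure) := by
      simp only [norm_mul, norm_pow, fourier_apply, Circle.norm_coe, mul_one, Complex.norm_real,
        Real.norm_eq_abs]
      rw [integral_const_mul]
      have : ‖(if n = 0 then 1 else 2 : ℂ)‖ ≤ 2 := by split_ifs <;> norm_num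
      calc ‖(if n = 0 then 1 else 2 : ℂ)‖ * ‖w‖ ^ n * ∫ ω, |u ω| ∂freqMeasure
          ≤ 2 * ‖w‖ ^ n * ∫ ω, |u ω| ∂freqMeasure := by
            have : 0 ≤ ∫ ω, |u ω| ∂freqMeasure := integral_nonneg fun _ => abs_nonneg _
            gcongr
        _ = _ := by ring
    exact Summable.of_nonneg_of_le (fun n => integral_nonneg fun _ => norm_nonneg _) hle
      ((summable_geometric_of_lt_one (norm_nonneg _) hw).mul_right _)
  have h := hasSum_integral_of_summable_integral_norm hI hS
  have hterm (n : ℕ) : ∫ ω, (if n = 0 then 1 else 2 : ℂ) * w ^ n * fourier (-(n : ℤ)) ω * (u ω : ℂ)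
      ∂freqMeasure = (herglotzCoeff u n : ℂ) * w ^ n := by
    have h1 : fourierCoeff (fun ω => (u ω : ℂ)) n =
        ∫ ω, fourier (-(n : ℤ)) ω * (u ω : ℂ) ∂freqMeasure := rfl
    simp only [mul_assoc]
    rw [integral_const_mul, integral_const_mul, ← h1, herglotzCoeff, Complex.ofReal_mul,
      fourierCoeff_of_even heven]
    split_ifs <;> push_cast <;> ring
  have hker (ω : Freq) : (∑' n : ℕ, (if n = 0 then 1 else 2 : ℂ) * w ^ n *
      fourier (-(n : ℤ)) ω * (u ω : ℂ)) =
        herglotzRieszKernel 0 w (AddCircle.toCircle ω : ℂ) * (u ω : ℂ) := by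
    rw [tsum_mul_right, (hasSum_herglotz hw ω).tsum_eq]
  simp only [hterm, hker] at h
  rw [h.tsum_eq]
  have hint : Integrable (fun ω => herglotzRieszKernel 0 w (AddCircle.toCircle ω : ℂ) * (u ω : ℂ))
      freqMeasure := by
    have hc : Continuous fun ω : Freq => herglotzRieszKernel 0 w (AddCircle.toCircle ω : ℂ) := by
      simp only [herglotzRieszKernel_def, sub_zero]
      exact (continuous_toCircle.add continuous_const).div
        (continuous_toCircle.sub continuous_const) (toCircle_sub_ne_zero hw)
    obtain ⟨C, hC⟩ := isCompact_univ.bddAbove_image hc.norm.continuousOn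
    exact hu.ofReal.bdd_mul hc.aestronglyMeasurable
      (Eventually.of_forall fun ω => hC ⟨ω, Set.mem_univ _, rfl⟩)
  rw [show ∀ z : ℂ, z.re = RCLike.re z from fun _ => rfl, ← integral_re hint]
  refine integral_congr_ae (Eventually.of_forall fun ω => ?_)
  simp [diskKernel, poissonKernel_eq_re_herglotzRieszKernel]

/-- The impulse response of the outer function `z ↦ exp (H (1 / z))`, where `H` is the Herglotz
integral of `u`: the modulus of its frequency response is `exp u`. -/
noncomputable def outerCoeff (u : Freq → ℝ) : ℕ → ℝ := expCoeff (herglotzCoeff u)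

section Outer

variable {u : Freq → ℝ}

theorem hasSum_outerCoeff (hu : Integrable u freqMeasure) {w : ℂ} (hw : ‖w‖ < 1) :
    HasSum (fun n => (outerCoeff u n : ℂ) * w ^ n)
      (Complex.exp (∑' n, (herglotzCoeff u n : ℂ) * w ^ n)) :=
  hasSum_expCoeff (abs_herglotzCoeff_le hu) hw

theorem norm_tsum_outerCoeff (hu : Integrable u freqMeasure)
    (heven : ∀ᵐ ω ∂freqMeasure, u (-ω) = u ω) {w : ℂ} (hw : ‖w‖ < 1) :
    ‖∑' n, (outerCoeff u n : ℂ) * w ^ n‖ =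
      Real.exp (∫ ω, diskKernel w ω * u ω ∂freqMeasure) := by
  rw [(hasSum_outerCoeff hu hw).tsum_eq, Complex.norm_exp, re_tsum_herglotzCoeff hu heven hw]

theorem norm_tsum_conj (c : ℕ → ℝ) (w : ℂ) :
    ‖∑' n, (c n : ℂ) * (starRingEnd ℂ w) ^ n‖ = ‖∑' n, (c n : ℂ) * w ^ n‖ := by
  rw [← RCLike.norm_conj, Complex.conj_tsum]
  simp

theorem norm_tsum_outerCoeff_conj (hu : Integrable u freqMeasure)
    (heven : ∀ᵐ ω ∂freqMeasure, u (-ω) = u ω) {w : ℂ} (hw : ‖w‖ < 1) :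
    ‖∑' n, (outerCoeff u n : ℂ) * w ^ n‖ =
      Real.exp (∫ ω, diskKernel (starRingEnd ℂ w) ω * u ω ∂freqMeasure) := by
  rw [← norm_tsum_conj, norm_tsum_outerCoeff hu heven (by rwa [RCLike.norm_conj])]

theorem summable_sq_of_summable_abs {c : ℕ → ℝ} (hc : Summable fun n => |c n|) :
    Summable fun n => c n ^ 2 := by
  have h := (hc.mul_of_nonneg hc (fun _ => abs_nonneg _) (fun _ => abs_nonneg _)).comp_injective
    (i := fun n => (n, n)) fun a b h => congrArg Prod.fst h
  refine h.congr fun n => ?_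
  simp only [Function.comp_apply, abs_mul_abs_self, pow_two]

theorem summable_abs_outerCoeff (hu : Integrable u freqMeasure) {r : ℝ} (hr : 0 ≤ r)
    (hr1 : r < 1) : Summable fun n => |outerCoeff u n * r ^ n| := by
  have h := (hasSum_outerCoeff hu (w := (r : ℂ))
    (by simpa [abs_of_nonneg hr] using hr1)).summable.norm
  refine h.congr fun n => ?_
  rw [← Complex.ofReal_pow, ← Complex.ofReal_mul, Complex.norm_real, Real.norm_eq_abs]

/-- On the circle of radius `r` the modulus of the outer function is the exponential of the Poisson
integral of `u`. -/
theorem norm_freqResponse_outerCoeff_radius (hu : Integrable u freqMeasure)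
    (heven : ∀ᵐ ω ∂freqMeasure, u (-ω) = u ω) {r : ℝ} (hr : 0 ≤ r) (hr1 : r < 1) :
    ∀ᵐ θ ∂freqMeasure, ‖freqResponse (fun n => outerCoeff u n * r ^ n) θ‖ =
      Real.exp (∫ ω, diskKernel (r * (AddCircle.toCircle θ : ℂ)) ω * u ω ∂freqMeasure) := by
  have hs := summable_abs_outerCoeff hu hr hr1
  filter_upwards [freqResponse_ae_eq_tsum hs (summable_sq_of_summable_abs hs)] with θ hθ
  rw [hθ]
  have h1 : (starRingEnd ℂ) (starRingEnd ℂ (r * (AddCircle.toCircle θ : ℂ))) =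
      r * (AddCircle.toCircle θ : ℂ) := Complex.conj_conj _
  rw [← h1, ← norm_tsum_outerCoeff_conj hu heven (by rwa [RCLike.norm_conj, norm_mul_toCircle hr])]
  congr 1
  refine tsum_congr fun n => ?_
  rw [fourier_neg, fourier_natCast, map_mul, mul_pow, map_pow, Complex.conj_ofReal]
  push_cast
  ring

/-- Jensen's inequality for the Poisson kernel and the exponential. -/
theorem exp_poisson_le (hu : Integrable u freqMeasure)
    (hexp : Integrable (fun ω => Real.exp (2 * u ω)) freqMeasure) {w : ℂ} (hw : ‖w‖ < 1) :
    Real.exp (2 * ∫ ω, diskKernel w ω * u ω ∂freqMeasure) ≤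
      ∫ ω, diskKernel w ω * Real.exp (2 * u ω) ∂freqMeasure := by
  set y := ∫ ω, diskKernel w ω * u ω ∂freqMeasure with hy
  have hK : Integrable (diskKernel w) freqMeasure :=
    integrable_of_continuous (continuous_diskKernel hw)
  have hKu : Integrable (fun ω => diskKernel w ω * u ω) freqMeasure :=
    integrable_diskKernel_smul hw hu
  have hKe : Integrable (fun ω => diskKernel w ω * Real.exp (2 * u ω)) freqMeasure :=
    integrable_diskKernel_smul hw hexp
  -- the tangent line of `exp` at `2 * y`
  have htan (x : ℝ) : Real.exp (2 * y) * (1 - 2 * y) + 2 * Real.exp (2 * y) * x ≤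
      Real.exp (2 * x) := by
    have h1 := Real.add_one_le_exp (2 * x - 2 * y)
    have h2 : Real.exp (2 * x) = Real.exp (2 * y) * Real.exp (2 * x - 2 * y) := by
      rw [← Real.exp_add]
      congr 1
      ring
    rw [h2]
    nlinarith [Real.exp_pos (2 * y)]
  calc Real.exp (2 * y)
      = ∫ ω, (Real.exp (2 * y) * (1 - 2 * y) * diskKernel w ω +
          2 * Real.exp (2 * y) * (diskKernel w ω * u ω)) ∂freqMeasure := by
        rw [integral_add (hK.const_mul _) (hKu.const_mul _), integral_const_mul,
          integral_const_mul, integral_diskKernel hw, ← hy]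
        ring
    _ ≤ _ := by
        refine integral_mono ((hK.const_mul _).add (hKu.const_mul _)) hKe fun ω => ?_
        have := mul_le_mul_of_nonneg_left (htan (u ω)) (diskKernel_nonneg hw ω)
        dsimp only
        linarith

theorem tsum_outerCoeff_radius_le (hu : Integrable u freqMeasure)
    (heven : ∀ᵐ ω ∂freqMeasure, u (-ω) = u ω)
    (hexp : Integrable (fun ω => Real.exp (2 * u ω)) freqMeasure) {r : ℝ} (hr : 0 ≤ r)
    (hr1 : r < 1) :
    ∑' n, ENNReal.ofReal ((outerCoeff u n * r ^ n) ^ 2) ≤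
      ∫⁻ ω, ENNReal.ofReal (Real.exp (2 * u ω)) ∂freqMeasure := by
  rw [← lintegral_freqResponse_sq (summable_sq_of_summable_abs (summable_abs_outerCoeff hu hr hr1)),
    ← lintegral_lintegral_diskKernel hr hr1 hexp.1.aemeasurable.ennreal_ofReal]
  refine lintegral_mono_ae ?_
  filter_upwards [norm_freqResponse_outerCoeff_radius hu heven hr hr1] with θ hθ
  have hw : ‖(r : ℂ) * (AddCircle.toCircle θ : ℂ)‖ < 1 := by rwa [norm_mul_toCircle hr]
  rw [← ofReal_norm, hθ, ← ENNReal.ofReal_pow (Real.exp_pos _).le, ← Real.exp_nat_mul]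
  refine (ENNReal.ofReal_le_ofReal (exp_poisson_le hu hexp hw)).trans_eq ?_
  have hint : Integrable (fun ω => diskKernel (r * (AddCircle.toCircle θ : ℂ)) ω *
      Real.exp (2 * u ω)) freqMeasure := integrable_diskKernel_smul hw hexp
  rw [ofReal_integral_eq_lintegral_ofReal hint (Eventually.of_forall fun ω =>
    mul_nonneg (diskKernel_nonneg hw ω) (Real.exp_pos _).le)]
  exact lintegral_congr fun ω => ENNReal.ofReal_mul (diskKernel_nonneg hw ω)

theorem summable_outerCoeff_sq (hu : Integrable u freqMeasure)
    (heven : ∀ᵐ ω ∂freqMeasure, u (-ω) = u ω)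
    (hexp : Integrable (fun ω => Real.exp (2 * u ω)) freqMeasure) :
    Summable fun n => outerCoeff u n ^ 2 := by
  rw [← tsum_ofReal_sq_lt_top_iff]
  refine lt_of_le_of_lt ?_ (hexp.lintegral_lt_top)
  refine ENNReal.tsum_le_of_sum_range_le fun N => ?_
  have hlim : Tendsto (fun r : ℝ => ∑ n ∈ Finset.range N,
      ENNReal.ofReal ((outerCoeff u n * r ^ n) ^ 2)) (𝓝[<] 1)
        (𝓝 (∑ n ∈ Finset.range N, ENNReal.ofReal (outerCoeff u n ^ 2))) := by
    have h : Continuous fun r : ℝ => ∑ n ∈ Finset.range N,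
        ENNReal.ofReal ((outerCoeff u n * r ^ n) ^ 2) :=
      continuous_finsetSum _ fun n _ => ENNReal.continuous_ofReal.comp (by fun_prop)
    have := (h.tendsto 1).mono_left (nhdsWithin_le_nhds (s := Set.Iio 1))
    simpa using this
  refine le_of_tendsto hlim ?_
  filter_upwards [eventually_mem_Ico] with r ⟨hr, hr1⟩
  exact (ENNReal.sum_le_tsum _).trans (tsum_outerCoeff_radius_le hu heven hexp hr hr1)

theorem tendsto_tsum_sub_radius_sq {c : ℕ → ℝ} (hc : Summable fun n => c n ^ 2) :
    Tendsto (fun r : ℝ => ∑' n, ENNReal.ofReal ((c n * r ^ n - c n) ^ 2)) (𝓝[<] 1) (𝓝 0) := by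
  have hb {r : ℝ} (hr : 0 ≤ r) (hr1 : r < 1) (n : ℕ) : (c n * r ^ n - c n) ^ 2 ≤ c n ^ 2 := by
    have h1 : c n * r ^ n - c n = c n * (r ^ n - 1) := by ring
    rw [h1, mul_pow]
    refine mul_le_of_le_one_right (sq_nonneg _) ?_
    have h2 := pow_nonneg hr n
    have h3 := pow_le_one₀ (n := n) hr hr1.le
    nlinarith
  have h : Tendsto (fun r : ℝ => ∑' n, (c n * r ^ n - c n) ^ 2) (𝓝[<] 1) (𝓝 (∑' _ : ℕ, 0)) := by
    refine tendsto_tsum_of_dominated_convergence hc (fun n => ?_) ?_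
    · have h1 : Continuous fun r : ℝ => (c n * r ^ n - c n) ^ 2 := by fun_prop
      have := (h1.tendsto 1).mono_left (nhdsWithin_le_nhds (s := Set.Iio 1))
      simpa using this
    · filter_upwards [eventually_mem_Ico] with r ⟨hr, hr1⟩ n
      rw [Real.norm_of_nonneg (sq_nonneg _)]
      exact hb hr hr1 n
  rw [tsum_zero] at h
  have h2 := ENNReal.tendsto_ofReal h
  rw [ENNReal.ofReal_zero] at h2
  refine h2.congr' ?_
  filter_upwards [eventually_mem_Ico] with r ⟨hr, hr1⟩
  exact ENNReal.ofReal_tsum_of_nonneg (fun _ => sq_nonneg _)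
    (Summable.of_nonneg_of_le (fun _ => sq_nonneg _) (hb hr hr1) hc)

/-- Radial limits of both sides of `|g(r e^{jθ})| = exp (P_r u (θ))`, along a sequence of radii that
makes the `L²` limit on the left and the `L¹` limit on the right almost everywhere limits. -/
theorem norm_freqResponse_outerCoeff (hu : Integrable u freqMeasure)
    (heven : ∀ᵐ ω ∂freqMeasure, u (-ω) = u ω)
    (hexp : Integrable (fun ω => Real.exp (2 * u ω)) freqMeasure) :
    ∀ᵐ ω ∂freqMeasure, ‖freqResponse (outerCoeff u) ω‖ = Real.exp (u ω) := by
  obtain ⟨ρ, -, hρ1, hρ⟩ := exists_seq_strictMono_tendsto' (show (0 : ℝ) < 1 by norm_num)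
  have hρ0 (n : ℕ) : 0 ≤ ρ n := (hρ1 n).1.le
  have hρlt (n : ℕ) : ρ n < 1 := (hρ1 n).2
  have hρw : Tendsto ρ atTop (𝓝[<] 1) :=
    tendsto_nhdsWithin_iff.2 ⟨hρ, Eventually.of_forall hρlt⟩
  have hc := summable_outerCoeff_sq hu heven hexp
  have hcr (n : ℕ) := summable_sq_of_summable_abs (summable_abs_outerCoeff hu (hρ0 n) (hρlt n))
  have hP : TendstoInMeasure freqMeasure
      (fun n θ => poissonInt (fun ω => (u ω : ℂ)) (ρ n * (AddCircle.toCircle θ : ℂ))) atTop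
      (fun ω => (u ω : ℂ)) := by
    refine tendstoInMeasure_of_tendsto_eLpNorm one_ne_zero (fun n =>
      aestronglyMeasurable_poissonInt (hρ0 n) (hρlt n) hu.ofReal.1) hu.ofReal.1 ?_
    simp only [eLpNorm_one_eq_lintegral_enorm]
    exact (tendsto_poissonDist hu.ofReal).comp hρw
  have hG : TendstoInMeasure freqMeasure
      (fun n => freqResponse fun k => outerCoeff u k * ρ n ^ k) atTop
      (freqResponse (outerCoeff u)) := by
    refine tendstoInMeasure_of_tendsto_eLpNorm two_ne_zero
      (fun n => Lp.aestronglyMeasurable _) (Lp.aestronglyMeasurable _) ?_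
    have h1 (n : ℕ) : eLpNorm (⇑(freqResponse fun k => outerCoeff u k * ρ n ^ k) -
        ⇑(freqResponse (outerCoeff u))) 2 freqMeasure =
          (∑' k, ENNReal.ofReal ((outerCoeff u k * ρ n ^ k - outerCoeff u k) ^ 2)) ^
            (1 / 2 : ℝ) := by
      have hdiff : Summable fun k => (outerCoeff u k * ρ n ^ k - outerCoeff u k) ^ 2 := by
        refine Summable.of_nonneg_of_le (fun _ => sq_nonneg _) (fun k => ?_)
          (((hcr n).mul_left 2).add (hc.mul_left 2))
        nlinarith [sq_nonneg (outerCoeff u k * ρ n ^ k + outerCoeff u k)]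
      rw [eLpNorm_congr_ae (Lp.coeFn_sub _ _).symm, ← freqResponse_sub (hcr n) hc hdiff,
        ← lintegral_freqResponse_sq hdiff, eLpNorm_eq_lintegral_rpow_enorm_toReal (by norm_num)
        (by norm_num)]
      simp
    simp only [h1]
    have h2 := ((tendsto_tsum_sub_radius_sq hc).comp hρw).ennrpow_const (1 / 2 : ℝ)
    simpa using h2
  obtain ⟨ns, hns, hPlim⟩ := hP.exists_seq_tendsto_ae
  obtain ⟨ms, hms, hGlim⟩ := (hG.comp hns.tendsto_atTop).exists_seq_tendsto_ae
  have hall := ae_all_iff.2 fun n =>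
    norm_freqResponse_outerCoeff_radius hu heven (hρ0 n) (hρlt n)
  filter_upwards [hPlim, hGlim, hall] with θ h1 h2 h3
  have h4 := ((Real.continuous_exp.comp Complex.continuous_re).tendsto _).comp
    (h1.comp hms.tendsto_atTop)
  refine tendsto_nhds_unique h2.norm (h4.congr fun n => ?_)
  simp only [Function.comp_apply, h3, poissonInt, Complex.real_smul, ← Complex.ofReal_mul]
  rw [integral_complex_ofReal, Complex.ofReal_re]

/-- The kernel in `IsMinimumPhase`, at a point `z` outside the unit disc, is the Poisson kernel of
the reflected point `1 / conj z`. -/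
theorem exteriorKernel_eq {z : ℂ} (hz : 1 < ‖z‖) (ω : Freq) :
    (‖z‖ ^ 2 - 1) / ‖z - (AddCircle.toCircle ω : ℂ)‖ ^ 2 =
      diskKernel (starRingEnd ℂ z⁻¹) ω := by
  have hz0 : z ≠ 0 := norm_pos_iff.1 (one_pos.trans hz)
  set e : ℂ := (AddCircle.toCircle ω : ℂ) with he
  have hee : e * (starRingEnd ℂ) e = 1 := by
    rw [Complex.mul_conj, Complex.normSq_eq_norm_sq, he, norm_toCircle]
    simp
  have hcz : (starRingEnd ℂ) z ≠ 0 := by simpa using hz0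
  have h1 : e - (starRingEnd ℂ) z⁻¹ = e * (starRingEnd ℂ) (z - e) / (starRingEnd ℂ) z := by
    rw [map_inv₀, map_sub]
    field_simp
    linear_combination hee
  have hw : ‖z⁻¹‖ < 1 := by
    rw [norm_inv]
    exact inv_lt_one_of_one_lt₀ hz
  have hne : z - e ≠ 0 := by
    intro h
    rw [sub_eq_zero.1 h, he, norm_toCircle] at hz
    exact hz.false
  rw [diskKernel_eq, ← he, h1, norm_div, norm_mul, RCLike.norm_conj, RCLike.norm_conj,
    RCLike.norm_conj, norm_inv, he, norm_toCircle, ← he]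
  have hp1 : ‖z‖ ≠ 0 := norm_ne_zero_iff.2 hz0
  have hp2 : ‖z - e‖ ≠ 0 := norm_ne_zero_iff.2 hne
  field_simp

theorem isMinimumPhase_outerCoeff (hu : Integrable u freqMeasure)
    (heven : ∀ᵐ ω ∂freqMeasure, u (-ω) = u ω)
    (hexp : Integrable (fun ω => Real.exp (2 * u ω)) freqMeasure) :
    IsMinimumPhase (outerCoeff u) := by
  have hlog : (fun ω => Real.log ‖freqResponse (outerCoeff u) ω‖) =ᵐ[freqMeasure] u := by
    filter_upwards [norm_freqResponse_outerCoeff hu heven hexp] with ω hω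
    rw [hω, Real.log_exp]
  refine ⟨hu.congr hlog.symm, fun z hz => ?_⟩
  have hw : ‖z⁻¹‖ < 1 := by
    rw [norm_inv]
    exact inv_lt_one_of_one_lt₀ hz
  constructor
  · rw [transfer, (hasSum_outerCoeff hu hw).tsum_eq]
    exact Complex.exp_ne_zero _
  · rw [transfer, norm_tsum_outerCoeff_conj hu heven hw, Real.log_exp]
    refine integral_congr_ae (hlog.mono fun ω hω => ?_)
    simp only [exteriorKernel_eq hz, hω]

end Outer

/-! ### The lower bound -/

theorem kappa_pos (δ : ℝ) {ε : ℝ} (hε : 0 < ε) : 0 < kappa δ ε := by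
  rw [kappa]
  set x := Function.invFun gaussianQ δ
  have h : |x| < √(x ^ 2 + 2 * ε) := by
    rw [← Real.sqrt_sq_eq_abs]
    exact Real.sqrt_lt_sqrt (sq_nonneg _) (by linarith)
  have := neg_abs_le x
  have : 0 < x + √(x ^ 2 + 2 * ε) := by linarith
  positivity

theorem lintegral_sum_mul_sq_le {ι α : Type*} [Fintype ι] [MeasurableSpace α] {μ : Measure α}
    {a b : ι → α → ℝ≥0∞} (ha : ∀ i, AEMeasurable (a i) μ) (hb : ∀ i, AEMeasurable (b i) μ) :
    (∫⁻ x, ∑ i, a i x * b i x ∂μ) ^ 2 ≤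
      (∫⁻ x, ∑ i, a i x ^ 2 ∂μ) * ∫⁻ x, ∑ i, b i x ^ 2 ∂μ := by
  have hpq : Real.HolderConjugate 2 2 := Real.HolderConjugate.two_two
  have hm {c : ι → α → ℝ≥0∞} (hc : ∀ i, AEMeasurable (c i) μ) :
      AEMeasurable (fun x => (∑ i, c i x ^ (2 : ℝ)) ^ (1 / 2 : ℝ)) μ :=
    (Finset.aemeasurable_fun_sum _ fun i _ => (hc i).pow_const _).pow_const _
  have hsq (x : ℝ≥0∞) : (x ^ (1 / 2 : ℝ)) ^ (2 : ℝ) = x := by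
    rw [← ENNReal.rpow_mul]; norm_num
  calc (∫⁻ x, ∑ i, a i x * b i x ∂μ) ^ 2
      ≤ (∫⁻ x, (∑ i, a i x ^ (2 : ℝ)) ^ (1 / 2 : ℝ) *
          (∑ i, b i x ^ (2 : ℝ)) ^ (1 / 2 : ℝ) ∂μ) ^ 2 := by
        gcongr with x
        exact ENNReal.inner_le_Lp_mul_Lq Finset.univ _ _ hpq
    _ ≤ ((∫⁻ x, ((∑ i, a i x ^ (2 : ℝ)) ^ (1 / 2 : ℝ)) ^ (2 : ℝ) ∂μ) ^ (1 / 2 : ℝ) *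
          (∫⁻ x, ((∑ i, b i x ^ (2 : ℝ)) ^ (1 / 2 : ℝ)) ^ (2 : ℝ) ∂μ) ^ (1 / 2 : ℝ)) ^ 2 := by
        gcongr
        exact ENNReal.lintegral_mul_le_Lp_mul_Lq μ hpq (hm ha) (hm hb)
    _ = _ := by
        rw [mul_pow, ← ENNReal.rpow_natCast, ← ENNReal.rpow_natCast]
        simp only [hsq, Nat.cast_ofNat]
        simp only [ENNReal.rpow_ofNat]

variable {m p : ℕ} {F : LTI m p} {k : Fin m → ℝ} {g : Fin m → ℕ → ℝ}

theorem ofReal_errorBound (F : LTI m p) (hk : ∀ i, 0 < k i) (δ ε : ℝ) :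
    ENNReal.ofReal (errorBound F k δ ε) = ENNReal.ofReal (kappa δ ε ^ 2) *
      (∫⁻ ω, ∑ i, ENNReal.ofReal (k i) * ENNReal.ofReal (F.colNorm i ω) ∂freqMeasure) ^ 2 := by
  have hnn (i : Fin m) (ω : Freq) : 0 ≤ k i * F.colNorm i ω :=
    mul_nonneg (hk i).le (F.colNorm_nonneg i ω)
  rw [errorBound, ENNReal.ofReal_mul (sq_nonneg _), ENNReal.ofReal_pow
    (integral_nonneg fun ω => Finset.sum_nonneg fun i _ => hnn i ω),
    ofReal_integral_eq_lintegral_ofReal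
      (integrable_finsetSum _ fun i _ => (F.integrable_colNorm i).const_mul (k i))
      (Eventually.of_forall fun ω => Finset.sum_nonneg fun i _ => hnn i ω)]
  congr 2
  refine lintegral_congr fun ω => ?_
  rw [ENNReal.ofReal_sum_of_nonneg fun i _ => hnn i ω]
  exact Finset.sum_congr rfl fun i _ => ENNReal.ofReal_mul (hk i).le

theorem aemeasurable_ofReal_colNorm (F : LTI m p) (i : Fin m) :
    AEMeasurable (fun ω => ENNReal.ofReal (F.colNorm i ω)) freqMeasure :=
  (F.aestronglyMeasurable_colNorm i).aemeasurable.ennreal_ofReal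

theorem aemeasurable_mul_freqResponse (c : ℝ≥0∞) (h : ℕ → ℝ) :
    AEMeasurable (fun ω => c * ‖freqResponse h ω‖ₑ) freqMeasure :=
  (Lp.aestronglyMeasurable _).enorm.const_mul _

/-- The squared sensitivity `‖G K‖₂²`, in the frequency domain. -/
theorem h2NormSq_scale_diag_eq_lintegral (hg : (LTI.diag g).IsStable) (hk : ∀ i, 0 < k i) :
    ((LTI.diag g).scale k).h2NormSq =
      ∫⁻ ω, ∑ i, (ENNReal.ofReal (k i) * ‖freqResponse (g i) ω‖ₑ) ^ 2 ∂freqMeasure := by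
  rw [lintegral_finsetSum' _ fun i _ => (aemeasurable_mul_freqResponse _ _).pow_const 2,
    LTI.h2NormSq_scale_diag]
  refine Finset.sum_congr rfl fun i _ => ?_
  simp only [mul_pow]
  rw [lintegral_const_mul' _ _ (by finiteness), lintegral_freqResponse_sq (hg.summable_diag i),
    ENNReal.ofReal_pow (hk i).le]

/-- The Cauchy–Schwarz step common to the two lower bounds: `b` plays the role of the column norms
of `F G⁻¹`. -/
theorem errorBound_le (hg : (LTI.diag g).IsStable) (hk : ∀ i, 0 < k i) (δ ε : ℝ)
    {b : Fin m → Freq → ℝ≥0∞} (hb : ∀ i, AEMeasurable (b i) freqMeasure)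
    (h : ∀ᵐ ω ∂freqMeasure, ∀ i,
      ENNReal.ofReal (F.colNorm i ω) ≤ ‖freqResponse (g i) ω‖ₑ * b i ω) :
    ENNReal.ofReal (errorBound F k δ ε) ≤ ENNReal.ofReal (kappa δ ε ^ 2) *
      ((LTI.diag g).scale k).h2NormSq * ∫⁻ ω, ∑ i, b i ω ^ 2 ∂freqMeasure := by
  rw [ofReal_errorBound F hk, mul_assoc, h2NormSq_scale_diag_eq_lintegral hg hk]
  gcongr
  refine le_trans ?_ (lintegral_sum_mul_sq_le
    (fun i => aemeasurable_mul_freqResponse (ENNReal.ofReal (k i)) (g i)) hb)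
  gcongr ?_ ^ 2
  refine lintegral_mono_ae (h.mono fun ω hω => Finset.sum_le_sum fun i _ => ?_)
  rw [mul_assoc]
  gcongr
  exact hω i

theorem scale_diag_h2NormSq_ne_zero (hk : ∀ i, 0 < k i) (i : Fin m) (hgi : g i ≠ 0) :
    ((LTI.diag g).scale k).h2NormSq ≠ 0 := by
  obtain ⟨t, ht⟩ := Function.ne_iff.1 hgi
  rw [LTI.h2NormSq_scale_diag]
  intro h0
  have h1 := (Finset.sum_eq_zero_iff.1 h0) i (Finset.mem_univ i)
  rcases mul_eq_zero.1 h1 with h2 | h2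
  · have := hk i
    exact (ENNReal.ofReal_pos.2 (by positivity)).ne' h2
  · have h3 := (ENNReal.tsum_eq_zero.1 h2) t
    have ht' : g i t ≠ 0 := ht
    exact (ENNReal.ofReal_pos.2 (by positivity)).ne' h3

theorem ofReal_kappa_sq_ne_zero (δ : ℝ) {ε : ℝ} (hε : 0 < ε) :
    ENNReal.ofReal (kappa δ ε ^ 2) ≠ 0 :=
  (ENNReal.ofReal_pos.2 (pow_pos (kappa_pos δ hε) 2)).ne'

theorem ofReal_norm_sq (x : ℂ) : ENNReal.ofReal (‖x‖ ^ 2) = ‖x‖ₑ ^ 2 := by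
  rw [ENNReal.ofReal_pow (norm_nonneg _), ofReal_norm]

theorem errorBound_le_freqError (hk : ∀ i, 0 < k i) (δ : ℝ) {ε : ℝ} (hε : 0 < ε)
    (hg : (LTI.diag g).IsStable) (hg0 : ∀ i, g i ≠ 0) :
    ENNReal.ofReal (errorBound F k δ ε) ≤ freqError F g k δ ε := by
  set b : Fin m → Freq → ℝ≥0∞ := fun i ω =>
    ENNReal.ofReal (F.colNorm i ω) / ‖freqResponse (g i) ω‖ₑ with hbdef
  have hb (i : Fin m) : AEMeasurable (b i) freqMeasure :=
    (aemeasurable_ofReal_colNorm F i).div (Lp.aestronglyMeasurable _).enorm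
  have hb2 (i : Fin m) (ω : Freq) : ENNReal.ofReal (F.colNorm i ω ^ 2) /
      ENNReal.ofReal (‖freqResponse (g i) ω‖ ^ 2) = b i ω ^ 2 := by
    rw [ofReal_norm_sq, ENNReal.ofReal_pow (F.colNorm_nonneg i ω), hbdef]
    simp only [div_eq_mul_inv, mul_pow, ENNReal.inv_pow]
  simp only [freqError, hb2]
  by_cases htop : ∫⁻ ω, ∑ i, b i ω ^ 2 ∂freqMeasure = ∞
  · rcases isEmpty_or_nonempty (Fin m) with hm | ⟨⟨i⟩⟩
    · simp at htop
    · rw [htop, ENNReal.mul_top (mul_ne_zero (ofReal_kappa_sq_ne_zero δ hε)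
        (scale_diag_h2NormSq_ne_zero hk i (hg0 i)))]
      exact le_top
  · refine errorBound_le hg hk δ ε hb ?_
    -- a finite integral forces `F_i` to vanish almost everywhere where `G_ii` does
    have hfin := ae_lt_top' (Finset.aemeasurable_fun_sum _ fun i _ => (hb i).pow_const 2) htop
    filter_upwards [hfin] with ω hω i
    have hi : b i ω ^ 2 < ∞ := ENNReal.sum_lt_top.1 hω i (Finset.mem_univ i)
    by_cases hG : ‖freqResponse (g i) ω‖ₑ = 0
    · by_cases hF : ENNReal.ofReal (F.colNorm i ω) = 0
      · rw [hF]; exact zero_le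
      · simp [hbdef, hG, ENNReal.div_zero hF] at hi
    · rw [hbdef, ENNReal.mul_div_cancel hG enorm_ne_top]

/-- If `H G = F` with `H` of finite energy, then `|F_i| = |G_ii| |H_i|` almost everywhere. -/
theorem colNorm_eq_of_comp_diag {H : LTI m p} (hH : H.h2NormSq < ∞) (hg : (LTI.diag g).IsStable)
    (hF : F.h2NormSq < ∞) (h : H.comp (LTI.diag g) = F) :
    ∀ᵐ ω ∂freqMeasure, ∀ i, F.colNorm i ω = ‖freqResponse (g i) ω‖ * H.colNorm i ω := by
  have hconv (i : Fin m) (j : Fin p) : (fun t => F t j i) = conv (fun t => H t j i) (g i) := by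
    funext t
    rw [← h, LTI.comp_diag_apply]
  have hprod : ∀ᵐ ω ∂freqMeasure, ∀ i j, freqResponse (fun t => F t j i) ω =
      freqResponse (fun t => H t j i) ω * freqResponse (g i) ω := by
    refine ae_all_iff.2 fun i => ae_all_iff.2 fun j => ?_
    have hs := LTI.summable_of_h2NormSq_lt_top hF j i
    simp only [hconv i j] at hs ⊢
    exact freqResponse_conv (LTI.summable_of_h2NormSq_lt_top hH j i) (hg.summable_diag i)
      (by simpa only [← hconv i j] using LTI.summable_of_h2NormSq_lt_top hF j i)
  filter_upwards [hprod] with ω hω i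
  rw [LTI.colNorm, LTI.colNorm]
  simp only [hω, norm_mul, mul_pow]
  rw [← Finset.sum_mul, Real.sqrt_mul (Finset.sum_nonneg fun _ _ => sq_nonneg _),
    Real.sqrt_sq (norm_nonneg _), mul_comm]

theorem ne_zero_of_comp_diag_eq_id {L : LTI m m} (hL : L.comp (LTI.diag g) = LTI.id m)
    (i : Fin m) : g i ≠ 0 := by
  intro h0
  have h := LTI.comp_diag_apply L g 0 i i
  rw [hL, h0] at h
  simp [LTI.id, conv] at h

theorem errorBound_le_mse (hF : F.h2NormSq < ∞) (hk : ∀ i, 0 < k i) (δ : ℝ) {ε : ℝ} (hε : 0 < ε)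
    {L : LTI m m} (hg : (LTI.diag g).IsStable) (hL : L.comp (LTI.diag g) = LTI.id m) :
    ENNReal.ofReal (errorBound F k δ ε) ≤
      noiseVar (LTI.diag g) k δ ε * (F.comp L).h2NormSq := by
  rw [noiseVar_diag g k hk hg]
  by_cases htop : (F.comp L).h2NormSq = ∞
  · rcases isEmpty_or_nonempty (Fin m) with hm | ⟨⟨i⟩⟩
    · simp [LTI.h2NormSq] at htop
    · rw [htop, ENNReal.mul_top (mul_ne_zero (ofReal_kappa_sq_ne_zero δ hε)
        (scale_diag_h2NormSq_ne_zero hk i (ne_zero_of_comp_diag_eq_id hL i)))]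
      exact le_top
  · have hH := lt_top_iff_ne_top.2 htop
    have hcomp : (F.comp L).comp (LTI.diag g) = F := by
      rw [LTI.comp_assoc, hL, LTI.comp_id]
    rw [← LTI.lintegral_colNorm_sq hH, ← lintegral_finsetSum' _ fun i _ =>
      ((F.comp L).aestronglyMeasurable_colNorm i).aemeasurable.pow_const 2 |>.ennreal_ofReal]
    simp only [ENNReal.ofReal_pow ((F.comp L).colNorm_nonneg _ _)]
    refine errorBound_le hg hk δ ε (fun i => aemeasurable_ofReal_colNorm _ i) ?_
    filter_upwards [colNorm_eq_of_comp_diag hH hg hF hcomp] with ω hω i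
    rw [hω i, ENNReal.ofReal_mul (norm_nonneg _), ofReal_norm]

/-! ### Division by an outer function -/

/-- Dividing a square-summable response `f` by the outer function of modulus `exp u` does not
produce more energy than the integral of `|f|² exp (-2u)`. The inverse of the outer function need
not be square summable, so it is approximated by the outer functions of modulus
`exp (min (-u) N)`, which are bounded. -/
theorem tsum_conv_outerCoeff_neg_le {f : ℕ → ℝ} (hf : Summable fun t => f t ^ 2) {u : Freq → ℝ}
    (hu : Integrable u freqMeasure) (heven : ∀ᵐ ω ∂freqMeasure, u (-ω) = u ω) :
    ∑' t, ENNReal.ofReal (conv f (outerCoeff fun ω => -u ω) t ^ 2) ≤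
      ∫⁻ ω, ‖freqResponse f ω‖ₑ ^ 2 * ENNReal.ofReal (Real.exp (-u ω)) ^ 2 ∂freqMeasure := by
  set v : ℕ → Freq → ℝ := fun N ω => min (-u ω) N with hv
  have hvabs (N : ℕ) (ω : Freq) : |v N ω| ≤ |u ω| := by
    have hN : (0 : ℝ) ≤ N := N.cast_nonneg
    simp only [hv]
    rcases min_choice (-u ω) (N : ℝ) with h | h
    · rw [h, abs_neg]
    · rw [h, abs_of_nonneg hN]
      have := min_le_left (-u ω) (N : ℝ)
      rw [h] at this
      exact this.trans (neg_le_abs _)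
  have hvm (N : ℕ) : AEStronglyMeasurable (v N) freqMeasure :=
    (hu.1.neg.aemeasurable.min aemeasurable_const).aestronglyMeasurable
  have hvi (N : ℕ) : Integrable (v N) freqMeasure :=
    hu.mono (hvm N) (Eventually.of_forall fun ω => hvabs N ω)
  have hve (N : ℕ) : ∀ᵐ ω ∂freqMeasure, v N (-ω) = v N ω :=
    heven.mono fun ω hω => by simp only [hv, hω]
  have hvexp (N : ℕ) : Integrable (fun ω => Real.exp (2 * v N ω)) freqMeasure := by
    refine Integrable.of_bound (Real.continuous_exp.comp_aestronglyMeasurable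
      ((hvm N).const_mul 2)) (Real.exp (2 * N)) (Eventually.of_forall fun ω => ?_)
    rw [Real.norm_of_nonneg (Real.exp_pos _).le]
    exact Real.exp_le_exp.2 (by simp only [hv]; linarith [min_le_right (-u ω) (N : ℝ)])
  have hle (N : ℕ) : ∑' t, ENNReal.ofReal (conv f (outerCoeff (v N)) t ^ 2) ≤
      ∫⁻ ω, ‖freqResponse f ω‖ₑ ^ 2 * ENNReal.ofReal (Real.exp (-u ω)) ^ 2 ∂freqMeasure := by
    refine (tsum_conv_sq_le hf (summable_outerCoeff_sq (hvi N) (hve N) (hvexp N))).trans ?_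
    refine lintegral_mono_ae ?_
    filter_upwards [norm_freqResponse_outerCoeff (hvi N) (hve N) (hvexp N)] with ω hω
    rw [← ofReal_norm (freqResponse (outerCoeff (v N)) ω), hω]
    gcongr
    exact min_le_left _ _
  have hL1 : Tendsto (fun N => 2 * ∫ ω, |v N ω - -u ω| ∂freqMeasure) atTop (𝓝 0) := by
    have h := tendsto_integral_of_dominated_convergence (μ := freqMeasure)
      (F := fun N ω => |v N ω - -u ω|) (f := fun _ => 0) (fun ω => 2 * |u ω|)
      (fun N => ((hvm N).sub hu.1.neg).norm) (hu.norm.const_mul 2)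
      (fun N => Eventually.of_forall fun ω => by
        rw [Real.norm_eq_abs, abs_abs]
        have h1 := abs_sub (v N ω) (-u ω)
        have h2 := hvabs N ω
        rw [abs_neg] at h1
        linarith)
      (Eventually.of_forall fun ω => by
        obtain ⟨N₀, hN₀⟩ := exists_nat_ge (-u ω)
        refine tendsto_const_nhds.congr' ?_
        filter_upwards [eventually_ge_atTop N₀] with N hN
        have : -u ω ≤ N := hN₀.trans (by exact_mod_cast hN)
        simp [hv, min_eq_left this])
    simpa using h.const_mul 2
  have hcoeff (n : ℕ) : Tendsto (fun N => outerCoeff (v N) n) atTop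
      (𝓝 (outerCoeff (fun ω => -u ω) n)) := by
    refine tendsto_expCoeff (fun n => ?_) n
    rw [tendsto_iff_dist_tendsto_zero]
    refine squeeze_zero (fun _ => dist_nonneg) (fun N => ?_) hL1
    rw [Real.dist_eq]
    exact abs_herglotzCoeff_sub_le (hvi N) hu.neg n
  refine ENNReal.tsum_le_of_sum_range_le fun T => ?_
  have hlim : Tendsto (fun N => ∑ t ∈ Finset.range T,
      ENNReal.ofReal (conv f (outerCoeff (v N)) t ^ 2)) atTop
      (𝓝 (∑ t ∈ Finset.range T, ENNReal.ofReal (conv f (outerCoeff fun ω => -u ω) t ^ 2))) := by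
    refine tendsto_finsetSum _ fun t _ => ENNReal.tendsto_ofReal (Tendsto.pow ?_ 2)
    exact tendsto_finsetSum _ fun s _ => (hcoeff s.2).const_mul _
  exact le_of_tendsto' hlim fun N => (ENNReal.sum_le_tsum _).trans (hle N)

/-! ### Attainment of the bound -/

/-- The logarithm of the optimal gain, `log |G_ii| = log (|F_i|₂ / k_i) / 2`. -/
noncomputable def optimalLogGain (F : LTI m p) (k : Fin m → ℝ) (i : Fin m) (ω : Freq) : ℝ :=
  Real.log (F.colNorm i ω / k i) / 2

theorem integrable_optimalLogGain (hk : ∀ i, 0 < k i) {i : Fin m} (h : F.PaleyWiener i) :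
    Integrable (optimalLogGain F k i) freqMeasure := by
  refine ((h.2.sub (integrable_const (Real.log (k i)))).div_const 2).congr ?_
  filter_upwards [h.1] with ω hω
  rw [optimalLogGain, Real.log_div hω (hk i).ne', Pi.sub_apply]

theorem optimalLogGain_neg (hF : F.h2NormSq < ∞) (i : Fin m) :
    ∀ᵐ ω ∂freqMeasure, optimalLogGain F k i (-ω) = optimalLogGain F k i ω :=
  (LTI.colNorm_neg hF i).mono fun ω hω => by simp only [optimalLogGain, hω]

theorem exp_optimalLogGain (hk : ∀ i, 0 < k i) {i : Fin m} (h : F.PaleyWiener i) :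
    ∀ᵐ ω ∂freqMeasure, 0 < F.colNorm i ω ∧
      Real.exp (2 * optimalLogGain F k i ω) = F.colNorm i ω / k i := by
  filter_upwards [h.1] with ω hω
  have hpos : 0 < F.colNorm i ω := lt_of_le_of_ne (F.colNorm_nonneg i ω) (Ne.symm hω)
  refine ⟨hpos, ?_⟩
  rw [optimalLogGain, mul_div_cancel₀ _ two_ne_zero, Real.exp_log (div_pos hpos (hk i))]

theorem integrable_exp_optimalLogGain (hk : ∀ i, 0 < k i) {i : Fin m} (h : F.PaleyWiener i) :
    Integrable (fun ω => Real.exp (2 * optimalLogGain F k i ω)) freqMeasure :=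
  ((F.integrable_colNorm i).div_const (k i)).congr
    ((exp_optimalLogGain hk h).mono fun _ hω => hω.2.symm)

/-- The optimal pre-filter: the outer functions with `|G_ii|² = |F_i|₂ / k_i`. -/
noncomputable def optimalFilter (F : LTI m p) (k : Fin m → ℝ) (i : Fin m) : ℕ → ℝ :=
  outerCoeff (optimalLogGain F k i)

theorem norm_freqResponse_optimalFilter (hF : F.h2NormSq < ∞) (hk : ∀ i, 0 < k i) {i : Fin m}
    (h : F.PaleyWiener i) : ∀ᵐ ω ∂freqMeasure, 0 < F.colNorm i ω ∧
      ‖freqResponse (optimalFilter F k i) ω‖ ^ 2 = F.colNorm i ω / k i := by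
  filter_upwards [exp_optimalLogGain hk h, norm_freqResponse_outerCoeff
    (integrable_optimalLogGain hk h) (optimalLogGain_neg hF i)
    (integrable_exp_optimalLogGain hk h)] with ω h1 h2
  refine ⟨h1.1, ?_⟩
  rw [← h1.2, optimalFilter, h2, ← Real.exp_nat_mul]
  norm_num

theorem isStable_optimalFilter (hF : F.h2NormSq < ∞) (hk : ∀ i, 0 < k i)
    (h : ∀ i, F.PaleyWiener i) : (LTI.diag (optimalFilter F k)).IsStable := by
  rw [LTI.IsStable, LTI.h2NormSq_diag]
  exact ENNReal.sum_lt_top.2 fun i _ => (tsum_ofReal_sq_lt_top_iff _).2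
    (summable_outerCoeff_sq (integrable_optimalLogGain hk (h i)) (optimalLogGain_neg hF i)
      (integrable_exp_optimalLogGain hk (h i)))

theorem diag_outerCoeff_neg_comp (u : Fin m → Freq → ℝ) :
    (LTI.diag fun i => outerCoeff fun ω => -u i ω).comp (LTI.diag fun i => outerCoeff (u i)) =
      LTI.id m := by
  funext t
  ext i j
  rw [LTI.comp_diag_apply]
  by_cases hij : i = j
  · subst hij
    have h : outerCoeff (fun ω => -u i ω) = expCoeff fun n => -herglotzCoeff (u i) n := by
      rw [outerCoeff]
      congr 1
      funext n
      exact herglotzCoeff_neg _ _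
    simp only [LTI.diag, Matrix.diagonal_apply_eq]
    rw [h, outerCoeff, conv_expCoeff_neg, LTI.id]
    split_ifs <;> simp
  · simp only [LTI.diag, Matrix.diagonal_apply_ne _ hij, conv, zero_mul, Finset.sum_const_zero,
      LTI.id]
    split_ifs <;> simp [hij]

theorem h2NormSq_scale_optimalFilter (hF : F.h2NormSq < ∞) (hk : ∀ i, 0 < k i)
    (h : ∀ i, F.PaleyWiener i) :
    ((LTI.diag (optimalFilter F k)).scale k).h2NormSq =
      ∫⁻ ω, ∑ i, ENNReal.ofReal (k i) * ENNReal.ofReal (F.colNorm i ω) ∂freqMeasure := by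
  rw [h2NormSq_scale_diag_eq_lintegral (isStable_optimalFilter hF hk h) hk]
  refine lintegral_congr_ae ?_
  filter_upwards [ae_all_iff.2 fun i => norm_freqResponse_optimalFilter hF hk (h i)] with ω hω
  refine Finset.sum_congr rfl fun i _ => ?_
  have := hk i
  rw [mul_pow, ← ofReal_norm_sq, (hω i).2, ← ENNReal.ofReal_pow this.le,
    ← ENNReal.ofReal_mul (sq_nonneg _), ← ENNReal.ofReal_mul this.le]
  congr 1
  field_simp

theorem h2NormSq_comp_inverse_optimalFilter_le (hF : F.h2NormSq < ∞) (hk : ∀ i, 0 < k i)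
    (h : ∀ i, F.PaleyWiener i) :
    (F.comp (LTI.diag fun i => outerCoeff fun ω => -optimalLogGain F k i ω)).h2NormSq ≤
      ∫⁻ ω, ∑ i, ENNReal.ofReal (k i) * ENNReal.ofReal (F.colNorm i ω) ∂freqMeasure := by
  rw [LTI.h2NormSq_eq, lintegral_finsetSum' _ fun i _ =>
    (aemeasurable_ofReal_colNorm F i).const_mul _]
  refine Finset.sum_le_sum fun i _ => ?_
  simp only [LTI.comp_diag_apply]
  refine (Finset.sum_le_sum fun j _ => tsum_conv_outerCoeff_neg_le
    (LTI.summable_of_h2NormSq_lt_top hF j i) (integrable_optimalLogGain hk (h i))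
    (optimalLogGain_neg hF i)).trans_eq ?_
  have hm (j : Fin p) : AEMeasurable (fun ω => ‖freqResponse (fun t => F t j i) ω‖ₑ ^ 2 *
      ENNReal.ofReal (Real.exp (-optimalLogGain F k i ω)) ^ 2) freqMeasure :=
    ((Lp.aestronglyMeasurable _).enorm.pow_const 2).mul
      ((Real.continuous_exp.comp_aestronglyMeasurable
        (integrable_optimalLogGain hk (h i)).1.neg).aemeasurable.ennreal_ofReal.pow_const 2)
  refine (lintegral_finsetSum' _ fun j _ => hm j).symm.trans ?_
  refine lintegral_congr_ae ?_
  filter_upwards [exp_optimalLogGain hk (h i)] with ω ⟨hpos, hω⟩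
  have := hk i
  rw [← Finset.sum_mul, ← LTI.ofReal_colNorm_sq, ← ENNReal.ofReal_pow (Real.exp_pos _).le,
    ← ENNReal.ofReal_mul (sq_nonneg _), ← ENNReal.ofReal_mul this.le, ← Real.exp_nat_mul]
  congr 1
  rw [show ((2 : ℕ) : ℝ) * -optimalLogGain F k i ω = -(2 * optimalLogGain F k i ω) by
    push_cast; ring, Real.exp_neg, hω]
  field_simp

theorem freqError_optimalFilter (hF : F.h2NormSq < ∞) (hk : ∀ i, 0 < k i)
    (h : ∀ i, F.PaleyWiener i) (δ ε : ℝ) :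
    freqError F (optimalFilter F k) k δ ε = ENNReal.ofReal (errorBound F k δ ε) := by
  rw [freqError, h2NormSq_scale_optimalFilter hF hk h, ofReal_errorBound F hk,
    pow_two (lintegral _ _), mul_assoc]
  congr 2
  refine lintegral_congr_ae ?_
  filter_upwards [ae_all_iff.2 fun i => norm_freqResponse_optimalFilter hF hk (h i)] with ω hω
  refine Finset.sum_congr rfl fun i _ => ?_
  obtain ⟨hpos, hω⟩ := hω i
  have := hk i
  rw [hω, ← ENNReal.ofReal_div_of_pos (by positivity), ← ENNReal.ofReal_mul this.le]
  congr 1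
  field_simp

end ZFE

theorem theorem7 {m p : ℕ} (F : ZFE.LTI m p) (hF : F.h2NormSq < ∞)
    (k : Fin m → ℝ) (hk : ∀ i, 0 < k i)
    (δ ε : ℝ) (hδ : 0 < δ) (hδ1 : δ < 1) (hε : 0 < ε) :
    -- every stable diagonal pre-filter `G = diag(g)` with a causal left inverse `L`
    (∀ (g : Fin m → ℕ → ℝ) (L : ZFE.LTI m m), (ZFE.LTI.diag g).IsStable →
      L.comp (ZFE.LTI.diag g) = ZFE.LTI.id m →
      ∃ e : ℝ≥0∞, ZFE.IsMSE F (ZFE.LTI.diag g) L k δ ε e ∧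
        ENNReal.ofReal (ZFE.errorBound F k δ ε) ≤ e) ∧
    -- every stable diagonal pre-filter with invertible transfer matrix, in the frequency domain
    (∀ g : Fin m → ℕ → ℝ, (ZFE.LTI.diag g).IsStable → (∀ i, g i ≠ 0) →
      ENNReal.ofReal (ZFE.errorBound F k δ ε) ≤ ZFE.freqError F g k δ ε) ∧
    -- attainment
    ((∀ i, F.PaleyWiener i) →
      ∃ (g : Fin m → ℕ → ℝ) (L : ZFE.LTI m m),
        (ZFE.LTI.diag g).IsStable ∧
        (∀ i, ZFE.IsMinimumPhase (g i)) ∧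
        (∀ i, ∀ᵐ ω ∂ZFE.freqMeasure,
          ‖ZFE.freqResponse (g i) ω‖ ^ 2 = 1 / k i * F.colNorm i ω) ∧
        L.comp (ZFE.LTI.diag g) = ZFE.LTI.id m ∧
        ZFE.IsMSE F (ZFE.LTI.diag g) L k δ ε (ENNReal.ofReal (ZFE.errorBound F k δ ε)) ∧
        ZFE.freqError F g k δ ε = ENNReal.ofReal (ZFE.errorBound F k δ ε)) := by
  refine ⟨fun g L hg hL => ⟨_, ZFE.isMSE_h2NormSq F _ L hL k δ ε,
    ZFE.errorBound_le_mse hF hk δ hε hg hL⟩,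
    fun g hg hg0 => ZFE.errorBound_le_freqError hk δ hε hg hg0, fun h => ?_⟩
  have hst := ZFE.isStable_optimalFilter hF hk h
  have hinv := ZFE.diag_outerCoeff_neg_comp fun i => ZFE.optimalLogGain F k i
  refine ⟨ZFE.optimalFilter F k, _, hst, fun i => ?_, fun i => ?_, hinv, ?_,
    ZFE.freqError_optimalFilter hF hk h δ ε⟩
  · exact ZFE.isMinimumPhase_outerCoeff (ZFE.integrable_optimalLogGain hk (h i))
      (ZFE.optimalLogGain_neg hF i) (ZFE.integrable_exp_optimalLogGain hk (h i))
  · filter_upwards [ZFE.norm_freqResponse_optimalFilter hF hk (h i)] with ω hω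
    rw [hω.2, one_div, div_eq_inv_mul]
  · have hle : (ZFE.noiseVar (ZFE.LTI.diag (ZFE.optimalFilter F k)) k δ ε : ℝ≥0∞) *
        (F.comp (ZFE.LTI.diag fun i => ZFE.outerCoeff fun ω =>
          -ZFE.optimalLogGain F k i ω)).h2NormSq ≤ ENNReal.ofReal (ZFE.errorBound F k δ ε) := by
      rw [ZFE.noiseVar_diag _ k hk hst, ZFE.h2NormSq_scale_optimalFilter hF hk h,
        ZFE.ofReal_errorBound F hk, pow_two (lintegral _ _), mul_assoc]
      gcongr
      exact ZFE.h2NormSq_comp_inverse_optimalFilter_le hF hk h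
    rw [le_antisymm (ZFE.errorBound_le_mse hF hk δ hε hst hinv) hle]
    exact ZFE.isMSE_h2NormSq F _ _ hinv k δ ε
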